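/- Let $N\ge 0$ and let $\mathbb R^{2N}$ have coordinates $\xi=(\xi_\mu)=(x^1,\dots,x^N,p_1,\dots,p_N)$. Write $\partial_\mu=\partial/\partial\xi^\mu$, $\partial_i=\partial/\partial x^i$, $\partial^p_i=\partial/\partial p_i$; repeated indices are summed, Latin indices run over $1,\dots,N$ and Greek ones over $1,\dots,2N$. Let $\Omega_{\mu\nu}=\sum_{n\ge0}\theta^n\Omega^n_{\mu\nu}(\xi)$ be a formal power series in $\theta$ with coefficients smooth on $\mathbb R^{2N}$, antisymmetric in $\mu,\nu$, with $\Omega^0=\begin{pmatrix}0&1\\-1&0\end{pmatrix}$. Put $\mathcal J_{\mu\nu\alpha}=\Omega_{\mu\sigma}\partial_\sigma\Omega_{\nu\alpha}+\Omega_{\alpha\sigma}\partial_\sigma\Omega_{\mu\nu}+\Omega_{\nu\sigma}\partial_\sigma\Omega_{\alpha\mu}=\sum_n\theta^n\mathcal J^n_{\mu\nu\alpha}$; the Jacobi identity for $\Omega$ is $\mathcal J=0$. A formal change of coordinates is $\eta_\mu=\xi_\mu+\sum_{n\ge1}\theta^n\eta^n_\mu(\xi)$ with smooth $\eta^n_\mu$;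 write $\eta^n=(y_n^i,\pi^n_i)$. It consists of formal Darboux coordinates if $\partial_\sigma\eta_\mu\,\Omega_{\sigma\rho}\,\partial_\rho\eta_\nu=\Omega^0_{\mu\nu}$ as formal series. For $n\ge1$ set $$F^n_{\mu\nu}=\Omega^n_{\mu\nu}+\sum_{m=1}^{n-1}\left[\partial_\sigma\eta^{n-m}_\mu\Omega^0_{\sigma\rho}\partial_\rho\eta^m_\nu+\partial_\sigma\eta^{n-m}_\mu\Omega^m_{\sigma\nu}+\Omega^{n-m}_{\mu\sigma}\partial_\sigma\eta^m_\nu\right]+\sum_{m=1}^{n-2}\sum_{k=1}^{n-m-1}\Omega^{n-m-k}_{\sigma\rho}\partial_\sigma\eta^k_\mu\partial_\rho\eta^m_\nu .$$ 1. A formal change of coordinates $\eta$ consists of formal Darboux coordinates if and only if for every $n\ge1$ $$\partial_\sigma\eta^n_\mu\Omega^0_{\sigma\nu}+\Omega^0_{\mu\sigma}\partial_\sigma\eta^n_\nu+F^n_{\mu\nu}=0.\tag{E$_n$}$$ 2. Let $n\ge1$ and let the lower-order coefficients $\eta^m$, $1\le m<n$, be arbitrary smooth functions. Then (E$_n$),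 as an equation for $\eta^n$, has a smooth solution on $\mathbb R^{2N}$ if and only if $$\Omega^0_{\alpha\beta}\partial_\beta F^n_{\mu\nu}+\mathrm{cycl.}(\alpha\mu\nu)=0\quad\text{for all }\alpha,\mu,\nu.\tag{I$_n$}$$ Assume (I$_n$). For smooth $f^n,g^n$ put $$y_n^i=\int_0^1p_jF^n_{ij}(x,sp)\,s\,ds+\partial^p_if^n,\qquad \pi^n_i=\int_0^1x^jF^n_{N+j\,N+i}(sx,p)\,s\,ds+\partial_ig^n.\tag{S$_n$}$$ These functions are smooth, and they solve (E$_n$) if and only if $f^n$ and $g^n$ satisfy the relation $$\partial_iy_n^j+\partial^p_j\pi^n_i=F^n_{N+i\,j}\quad\text{for all } i,j.\tag{R$_n$}$$ For every smooth $g^n$ there is exactly one smooth $f^n$ such that (R$_n$) holds and $f^n+g^n$ vanishes at all points with $x=0$ or $p=0$. Let $\eta^n[g^n]$ denote the solution (S$_n$) with this $f^n$. Every smooth solution of (E$_n$) equals $\eta^n[g^n]$ for some smooth $g^n$, and $g^n$ is unique precisely up to an additive constant. 3. Let $n\ge1$, let $\mathcal J^r=0$ for all $r<n$, and let $\eta^1,\eta^2,\dots$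 be smooth. Then $$\begin{aligned}&\sum_{m=1}^{n-3}\sum_{k=1}^{n-m-2}\sum_{l=1}^{n-m-k-1}\Big[\partial_\sigma\eta^m_\mu\Omega^0_{\rho\sigma}\partial_\rho\big(\partial_\beta\eta^l_\nu\Omega^{n-m-k-l}_{\beta\gamma}\partial_\gamma\eta^k_\alpha\big)+\partial_\sigma\eta^m_\mu\Omega^k_{\rho\sigma}\partial_\rho\big(\partial_\beta\eta^{n-m-k-l}_\nu\Omega^0_{\beta\gamma}\partial_\gamma\eta^l_\alpha\big)\Big]\\&+\sum_{m=1}^{n-4}\sum_{k=1}^{n-m-3}\sum_{l=1}^{n-m-k-2}\sum_{q=1}^{n-m-k-l-1}\partial_\sigma\eta^m_\mu\Omega^q_{\rho\sigma}\partial_\rho\big(\partial_\beta\eta^l_\nu\Omega^{n-m-k-l-q}_{\beta\gamma}\partial_\gamma\eta^k_\alpha\big)+\mathrm{cycl.}(\alpha\mu\nu)=0\end{aligned}$$ and $$\sum_{m=1}^{n-2}\sum_{k=1}^{n-m-1}\partial_\sigma\eta^m_\mu\Omega^0_{\rho\sigma}\partial_\rho\big(\partial_\beta\eta^{n-m-k}_\nu\Omega^0_{\beta\gamma}\partial_\gamma\eta^k_\alpha\big)+\mathrm{cycl.}(\alpha\mu\nu)=0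 .$$ If moreover (E$_m$) holds for $1\le m<n$, then $\Omega^0_{\alpha\beta}\partial_\beta F^n_{\mu\nu}+\mathrm{cycl.}(\alpha\mu\nu)=\mathcal J^n_{\alpha\mu\nu}$; that is, (I$_n$) is exactly the Jacobi identity in order $n$. 4. Assume the Jacobi identity for $\Omega$ in all orders. Then (I$_n$) holds for every $n\ge1$ as soon as (E$_m$) holds for all $1\le m<n$, and formal Darboux coordinates exist. For every formal series $g(x,p,\theta)=\sum_n\theta^ng^n(x,p)$ with smooth coefficients there is exactly one system of formal Darboux coordinates $\eta$ with $\eta^n=\eta^n[g^n]$ for all $n\ge1$. Conversely, every system of formal Darboux coordinates arises in this way from such a $g$, and two series $g,g'$ give the same coordinates if and only if $g'^n-g^n$ is constant for every $n\ge1$. -/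

import Mathlib

open scoped ContDiff

namespace FormalDarboux

noncomputable section

/-- The index set of the phase space coordinates: `Sum.inl i` is the position index `i` and
`Sum.inr i` is the momentum index `N + i`. -/
abbrev Idx (N : ℕ) : Type := Fin N ⊕ Fin N

/-- The phase space `ℝ^{2N}`; a point is `ξ = (x, p)` with `x i = ξ (Sum.inl i)` and
`p i = ξ (Sum.inr i)`. -/
abbrev Phase (N : ℕ) : Type := Idx N → ℝ

/-- Real functions on phase space. -/
abbrev Fn (N : ℕ) : Type := Phase N → ℝ

/-- Formal power series in the parameter `θ` whose coefficients are functions on phase space. -/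
abbrev FSer (N : ℕ) : Type := PowerSeries (Fn N)

/-- The partial derivative `∂f/∂ξ^σ`. -/
def pd {N : ℕ} (σ : Idx N) (f : Fn N) : Fn N := fun ξ => fderiv ℝ f ξ (Pi.single σ 1)

/-- The partial derivative `∂/∂ξ^σ` of a formal series, taken coefficientwise. -/
def pdSer {N : ℕ} (σ : Idx N) (f : FSer N) : FSer N :=
  PowerSeries.mk fun n => pd σ (PowerSeries.coeff n f)

/-- All coefficients of the series are smooth. -/
def SmoothSer {N : ℕ} (f : FSer N) : Prop := ∀ n : ℕ, ContDiff ℝ ∞ (PowerSeries.coeff n f)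

/-- The canonical symplectic matrix `Ω⁰`. -/
def Omega0 (N : ℕ) : Matrix (Idx N) (Idx N) ℝ := Matrix.fromBlocks 0 1 (-1) 0

/-- The left-hand side of the Jacobi identity
`Ω_{μσ} ∂_σ Ω_{να} + Ω_{ασ} ∂_σ Ω_{μν} + Ω_{νσ} ∂_σ Ω_{αμ}`, a formal series. -/
def jacobiator {N : ℕ} (Ω : Matrix (Idx N) (Idx N) (FSer N)) (μ ν α : Idx N) : FSer N :=
  ∑ σ, (Ω μ σ * pdSer σ (Ω ν α) + Ω α σ * pdSer σ (Ω μ ν) + Ω ν σ * pdSer σ (Ω α μ))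

/-- A deformation `Ω = Ω⁰ + ∑_{n ≥ 1} θ^n Ω^n` of the canonical symplectic matrix:
smooth coefficients, antisymmetric, zeroth coefficient `Ω⁰`. The Jacobi identity is not part of
this definition. -/
structure IsDeformation {N : ℕ} (Ω : Matrix (Idx N) (Idx N) (FSer N)) : Prop where
  smooth : ∀ μ ν, SmoothSer (Ω μ ν)
  antisymm : ∀ μ ν, Ω ν μ = -Ω μ ν
  zeroth : ∀ μ ν, PowerSeries.coeff 0 (Ω μ ν) = fun _ => Omega0 N μ ν

/-- The Jacobi identity for `Ω`, in all orders in `θ`. -/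
def Jacobi {N : ℕ} (Ω : Matrix (Idx N) (Idx N) (FSer N)) : Prop :=
  ∀ μ ν α, jacobiator Ω μ ν α = 0

/-- The Poisson bracket `{f, g} = ∂_σ f Ω_{σρ} ∂_ρ g` of formal series. -/
def bracket {N : ℕ} (Ω : Matrix (Idx N) (Idx N) (FSer N)) (f g : FSer N) : FSer N :=
  ∑ σ, ∑ ρ, pdSer σ f * Ω σ ρ * pdSer ρ g

/-- A formal change of coordinates `η = ξ + ∑_{n ≥ 1} θ^n η^n` with smooth coefficients. -/
structure IsFormalChange {N : ℕ} (η : Idx N → FSer N) : Prop where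
  smooth : ∀ μ, SmoothSer (η μ)
  zeroth : ∀ μ, PowerSeries.coeff 0 (η μ) = fun ξ => ξ μ

/-- Formal Darboux coordinates: a formal change of coordinates with `{η_μ, η_ν} = Ω⁰_{μν}`. -/
structure IsDarboux {N : ℕ} (Ω : Matrix (Idx N) (Idx N) (FSer N)) (η : Idx N → FSer N) :
    Prop where
  change : IsFormalChange η
  canonical : ∀ μ ν, bracket Ω (η μ) (η ν) = PowerSeries.C (fun _ => Omega0 N μ ν)

/-- The inhomogeneity `F^n_{μν}` of the order-`n` Darboux equation. It only involves the
coefficients `η^m` with `1 ≤ m ≤ n - 1`. -/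
def inhom {N : ℕ} (Ω : Matrix (Idx N) (Idx N) (FSer N)) (η : Idx N → FSer N) (n : ℕ)
    (μ ν : Idx N) : Fn N := fun ξ =>
  PowerSeries.coeff n (Ω μ ν) ξ
  + ∑ m ∈ Finset.Icc 1 (n - 1),
      ((∑ σ, ∑ ρ, pd σ (PowerSeries.coeff (n - m) (η μ)) ξ * Omega0 N σ ρ
          * pd ρ (PowerSeries.coeff m (η ν)) ξ)
        + (∑ σ, pd σ (PowerSeries.coeff (n - m) (η μ)) ξ * PowerSeries.coeff m (Ω σ ν) ξ)
        + ∑ σ, PowerSeries.coeff (n - m) (Ω μ σ) ξ * pd σ (PowerSeries.coeff m (η ν)) ξ)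
  + ∑ m ∈ Finset.Icc 1 (n - 2), ∑ k ∈ Finset.Icc 1 (n - m - 1), ∑ σ, ∑ ρ,
      PowerSeries.coeff (n - m - k) (Ω σ ρ) ξ * pd σ (PowerSeries.coeff k (η μ)) ξ
        * pd ρ (PowerSeries.coeff m (η ν)) ξ

/-- The Darboux equation of a fixed order for the unknown `e = (e_μ)` with inhomogeneity `F`:
`∂_σ e_μ Ω⁰_{σν} + Ω⁰_{μσ} ∂_σ e_ν + F_{μν} = 0`. -/
def DarbouxEq {N : ℕ} (F : Idx N → Idx N → Fn N) (e : Idx N → Fn N) : Prop :=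
  ∀ μ ν ξ, (∑ σ, pd σ (e μ) ξ * Omega0 N σ ν) + (∑ σ, Omega0 N μ σ * pd σ (e ν) ξ) + F μ ν ξ = 0

/-- The order-`n` Darboux equation for the coefficient `η^n`. -/
def DarbouxEqAt {N : ℕ} (Ω : Matrix (Idx N) (Idx N) (FSer N)) (η : Idx N → FSer N) (n : ℕ) :
    Prop :=
  DarbouxEq (inhom Ω η n) fun μ => PowerSeries.coeff n (η μ)

/-- The expression `Ω⁰_{αβ} ∂_β F_{μν} + cycl.(αμν)`. -/
def cyclicDeriv {N : ℕ} (F : Idx N → Idx N → Fn N) (α μ ν : Idx N) : Fn N := fun ξ =>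
  ∑ β, (Omega0 N α β * pd β (F μ ν) ξ + Omega0 N μ β * pd β (F ν α) ξ
    + Omega0 N ν β * pd β (F α μ) ξ)

/-- The integrability condition `Ω⁰_{αβ} ∂_β F_{μν} + cycl.(αμν) = 0`. -/
def Integrability {N : ℕ} (F : Idx N → Idx N → Fn N) : Prop :=
  ∀ α μ ν ξ, cyclicDeriv F α μ ν ξ = 0

/-- `(x, p) ↦ (x, s p)`. -/
def scaleP {N : ℕ} (s : ℝ) (ξ : Phase N) : Phase N :=
  Sum.elim (fun i => ξ (Sum.inl i)) fun i => s * ξ (Sum.inr i)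

/-- `(x, p) ↦ (s x, p)`. -/
def scaleX {N : ℕ} (s : ℝ) (ξ : Phase N) : Phase N :=
  Sum.elim (fun i => s * ξ (Sum.inl i)) fun i => ξ (Sum.inr i)

/-- The integral formulas: the components of the result are
`y^i = ∫₀¹ p_j F_{ij}(x, s p) s ds + ∂f/∂p_i` and
`π_i = ∫₀¹ x^j F_{N+j,N+i}(s x, p) s ds + ∂g/∂x^i`. -/
def integralSol {N : ℕ} (F : Idx N → Idx N → Fn N) (f g : Fn N) : Idx N → Fn N :=
  Sum.elim
    (fun i ξ => (∫ s in (0 : ℝ)..1,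
        (∑ j, ξ (Sum.inr j) * F (Sum.inl i) (Sum.inl j) (scaleP s ξ)) * s)
      + pd (Sum.inr i) f ξ)
    (fun i ξ => (∫ s in (0 : ℝ)..1,
        (∑ j, ξ (Sum.inl j) * F (Sum.inr j) (Sum.inr i) (scaleX s ξ)) * s)
      + pd (Sum.inl i) g ξ)

/-- The relation between `f` and `g`: the mixed components
`∂y^j/∂x^i + ∂π_i/∂p_j = F_{N+i,j}` of the Darboux equation. -/
def MixedRelation {N : ℕ} (F : Idx N → Idx N → Fn N) (f g : Fn N) : Prop :=
  ∀ (i j : Fin N) (ξ : Phase N),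
    pd (Sum.inl i) (integralSol F f g (Sum.inl j)) ξ
      + pd (Sum.inr j) (integralSol F f g (Sum.inr i)) ξ = F (Sum.inr i) (Sum.inl j) ξ

/-- `f + g` vanishes wherever `x = 0` or `p = 0`. -/
def Normalized {N : ℕ} (f g : Fn N) : Prop :=
  ∀ ξ : Phase N, ((∀ i, ξ (Sum.inl i) = 0) ∨ (∀ i, ξ (Sum.inr i) = 0)) → f ξ + g ξ = 0

/-- `e` is given by the integral formulas with the smooth function `g` and a smooth function `f`
tied to `g` by the mixed relation and the normalization. -/
def Generates {N : ℕ} (F : Idx N → Idx N → Fn N) (g : Fn N) (e : Idx N → Fn N) : Prop :=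
  ContDiff ℝ ∞ g ∧ ∃ f : Fn N, ContDiff ℝ ∞ f ∧ MixedRelation F f g ∧ Normalized f g ∧
    e = integralSol F f g

/-- The formal change of coordinates `η` is given, in every order `n ≥ 1`, by the integral
formulas with generating function `g^n`. -/
def GeneratesSer {N : ℕ} (Ω : Matrix (Idx N) (Idx N) (FSer N)) (g : FSer N)
    (η : Idx N → FSer N) : Prop :=
  IsFormalChange η ∧ ∀ n : ℕ, 1 ≤ n →
    Generates (inhom Ω η n) (PowerSeries.coeff n g) fun μ => PowerSeries.coeff n (η μ)

/-- The expression `∂_σ a L_{ρσ} ∂_ρ (∂_β b L'_{βγ} ∂_γ c)`. -/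
def nested {N : ℕ} (L L' : Idx N → Idx N → Fn N) (a b c : Fn N) : Fn N := fun ξ =>
  ∑ σ, ∑ ρ, pd σ a ξ * L ρ σ ξ
    * pd ρ (fun ζ => ∑ β, ∑ γ, pd β b ζ * L' β γ ζ * pd γ c ζ) ξ

/-- The coefficient `Ω^n` as a matrix of functions. -/
def coeffMat {N : ℕ} (Ω : Matrix (Idx N) (Idx N) (FSer N)) (n : ℕ) : Idx N → Idx N → Fn N :=
  fun μ ν => PowerSeries.coeff n (Ω μ ν)

/-- The sums, before the cyclic summation, in the first of the two auxiliary identities. -/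
def sumM {N : ℕ} (Ω : Matrix (Idx N) (Idx N) (FSer N)) (η : Idx N → FSer N) (n : ℕ)
    (μ ν α : Idx N) : Fn N := fun ξ =>
  (∑ m ∈ Finset.Icc 1 (n - 3), ∑ k ∈ Finset.Icc 1 (n - m - 2),
    ∑ l ∈ Finset.Icc 1 (n - m - k - 1),
      (nested (fun ρ σ _ => Omega0 N ρ σ) (coeffMat Ω (n - m - k - l))
          (PowerSeries.coeff m (η μ)) (PowerSeries.coeff l (η ν)) (PowerSeries.coeff k (η α)) ξ
        + nested (coeffMat Ω k) (fun β γ _ => Omega0 N β γ)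
          (PowerSeries.coeff m (η μ)) (PowerSeries.coeff (n - m - k - l) (η ν))
          (PowerSeries.coeff l (η α)) ξ))
  + ∑ m ∈ Finset.Icc 1 (n - 4), ∑ k ∈ Finset.Icc 1 (n - m - 3),
    ∑ l ∈ Finset.Icc 1 (n - m - k - 2), ∑ p ∈ Finset.Icc 1 (n - m - k - l - 1),
      nested (coeffMat Ω p) (coeffMat Ω (n - m - k - l - p))
        (PowerSeries.coeff m (η μ)) (PowerSeries.coeff l (η ν)) (PowerSeries.coeff k (η α)) ξ

/-- The sums, before the cyclic summation, in the second of the two auxiliary identities. -/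
def sumN {N : ℕ} (η : Idx N → FSer N) (n : ℕ) (μ ν α : Idx N) : Fn N := fun ξ =>
  ∑ m ∈ Finset.Icc 1 (n - 2), ∑ k ∈ Finset.Icc 1 (n - m - 1),
    nested (fun ρ σ _ => Omega0 N ρ σ) (fun β γ _ => Omega0 N β γ)
      (PowerSeries.coeff m (η μ)) (PowerSeries.coeff (n - m - k) (η ν))
      (PowerSeries.coeff k (η α)) ξ

end

end FormalDarboux

open FormalDarboux

namespace FormalDarboux

variable {N : ℕ}

/-! ### Calculus of partial derivatives of smooth functions on phase space. -/

section PartialDerivatives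

/-! In a fixed order the problem is a Poincaré lemma. The derivations `D_μ = Ω⁰_{μσ} ∂_σ` commute,
and the order-`n` equation reads `F_{μν} = D_ν e_μ - D_μ e_ν`: the array `F` is exact. Integrability
is closedness of `F`, necessary because `D ∘ D` antisymmetrizes to zero. For sufficiency, radial
integrals in `p` alone and in `x` alone solve the two pure blocks (`pd_potential_sub`), up to
gradients `∂_p f` and `∂_x g`. The mixed block then prescribes `∂_x ∂_p (f + g)`. This prescribed
matrix is closed in each index, so two successive homotopies integrate it
(`exists_mixed_primitive`). The kernel consists of sums `a(x) + b(p)`, and the normalization on `x =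
0` and `p = 0` removes it (`eq_zero_of_mixed_eq_zero`).

The link with Jacobi is the identity `{a,{b,c}} + cycl. = ∂_σ a ∂_β b ∂_γ c J_{σβγ}`, valid for
every antisymmetric `Ω` (`bracket_cyclic_sum`). Apply it to coordinates cut off below order `n`. The
lower Darboux equations make `{η_μ, η_ν}` constant below order `n`, and its order-`n` coefficient is
`F^n`, so order `n` of the identity says that the cyclic derivative of `F^n` is `J^n`
(`cyclicDeriv_inhom`). The auxiliary identities come from the same formula applied to
`θ`-independent functions, summed over compositions of `n`.

With Jacobi in all orders, each order is solvable once the lower ones are solved, and `F^n` sees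
only lower orders. Strong induction then constructs the coordinates and proves their uniqueness. -/

theorem smooth_differentiable {f : Fn N} (hf : ContDiff ℝ ∞ f) : Differentiable ℝ f :=
  hf.differentiable (by simp)

theorem fderiv_apply_eq_sum_pd (f : Fn N) (ξ v : Phase N) :
    fderiv ℝ f ξ v = ∑ σ, v σ * pd σ f ξ := by
  conv_lhs => rw [pi_eq_sum_univ' v, map_sum]
  refine Finset.sum_congr rfl fun σ _ => ?_
  rw [map_smul, smul_eq_mul]
  rfl

theorem contDiff_pd {f : Fn N} (hf : ContDiff ℝ ∞ f) (σ : Idx N) : ContDiff ℝ ∞ (pd σ f) :=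
  (hf.fderiv_right (m := ∞) (by simp)).clm_apply contDiff_const

theorem pd_comm {f : Fn N} (hf : ContDiff ℝ ∞ f) (σ ρ : Idx N) :
    pd σ (pd ρ f) = pd ρ (pd σ f) := by
  funext ξ
  have hd : DifferentiableAt ℝ (fderiv ℝ f) ξ :=
    ((hf.fderiv_right (m := ∞) (by simp)).differentiable (by simp)).differentiableAt
  have key : ∀ a b : Idx N, pd a (pd b f) ξ
      = fderiv ℝ (fderiv ℝ f) ξ (Pi.single a 1) (Pi.single b 1) := by
    intro a b
    have : HasFDerivAt (pd b f)
        ((ContinuousLinearMap.apply ℝ ℝ (Pi.single b (1 : ℝ) : Phase N)).comp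
          (fderiv ℝ (fderiv ℝ f) ξ)) ξ :=
      (ContinuousLinearMap.apply ℝ ℝ (Pi.single b (1 : ℝ) : Phase N)).hasFDerivAt.comp ξ
        hd.hasFDerivAt
    rw [pd, this.fderiv]
    rfl
  rw [key, key]
  have hs : IsSymmSndFDerivAt ℝ f ξ :=
    hf.contDiffAt.isSymmSndFDerivAt (by
      rw [minSmoothness_of_isRCLikeNormedField]
      exact WithTop.coe_le_coe.2 le_top)
  exact hs.eq _ _

theorem smooth_neg {f : Fn N} (hf : ContDiff ℝ ∞ f) : ContDiff ℝ ∞ (-f) := hf.neg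

theorem smooth_mul {f g : Fn N} (hf : ContDiff ℝ ∞ f) (hg : ContDiff ℝ ∞ g) :
    ContDiff ℝ ∞ (f * g) := hf.mul hg

theorem smooth_add {f g : Fn N} (hf : ContDiff ℝ ∞ f) (hg : ContDiff ℝ ∞ g) :
    ContDiff ℝ ∞ (f + g) := hf.add hg

theorem smooth_sub {f g : Fn N} (hf : ContDiff ℝ ∞ f) (hg : ContDiff ℝ ∞ g) :
    ContDiff ℝ ∞ (f - g) := hf.sub hg

theorem pd_const (σ : Idx N) (c : ℝ) : pd σ (fun _ => c) = 0 := by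
  funext ξ; simp [pd]

@[simp] theorem pd_zero (σ : Idx N) : pd σ (0 : Fn N) = 0 := pd_const σ 0

theorem pd_coord (σ μ : Idx N) (ξ : Phase N) :
    pd σ (fun ζ => ζ μ) ξ = if σ = μ then 1 else 0 := by
  have : HasFDerivAt (fun ζ : Phase N => ζ μ)
    (ContinuousLinearMap.proj (R := ℝ) (φ := fun _ : Idx N => ℝ) μ) ξ :=
    (ContinuousLinearMap.proj (R := ℝ) (φ := fun _ : Idx N => ℝ) μ).hasFDerivAt
  rw [pd, this.fderiv]
  simp [Pi.single_apply, eq_comm]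

theorem pd_add {f g : Fn N} (hf : ContDiff ℝ ∞ f) (hg : ContDiff ℝ ∞ g) (σ : Idx N) :
    pd σ (f + g) = pd σ f + pd σ g := by
  funext ξ
  simp [pd, fderiv_add (smooth_differentiable hf ξ) (smooth_differentiable hg ξ)]

@[simp] theorem pd_neg (f : Fn N) (σ : Idx N) : pd σ (-f) = -pd σ f := by
  funext ξ
  simp [pd, fderiv_neg]

theorem pd_sub {f g : Fn N} (hf : ContDiff ℝ ∞ f) (hg : ContDiff ℝ ∞ g) (σ : Idx N) :
    pd σ (f - g) = pd σ f - pd σ g := by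
  rw [sub_eq_add_neg, pd_add hf (smooth_neg hg), pd_neg, sub_eq_add_neg]

theorem pd_mul {f g : Fn N} (hf : ContDiff ℝ ∞ f) (hg : ContDiff ℝ ∞ g) (σ : Idx N) :
    pd σ (f * g) = pd σ f * g + f * pd σ g := by
  funext ξ
  simp only [pd, fderiv_mul (smooth_differentiable hf ξ) (smooth_differentiable hg ξ)]
  simp only [add_apply, smul_apply, smul_eq_mul, Pi.add_apply, Pi.mul_apply, pd]
  ring

theorem pd_sum {ι : Type*} {s : Finset ι} {f : ι → Fn N} (hf : ∀ i ∈ s, ContDiff ℝ ∞ (f i))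
    (σ : Idx N) : pd σ (∑ i ∈ s, f i) = ∑ i ∈ s, pd σ (f i) := by
  funext ξ
  rw [pd, fderiv_sum fun i hi => smooth_differentiable (hf i hi) ξ]
  simp [pd, Finset.sum_apply]

theorem contDiff_finsetSum {ι : Type*} {s : Finset ι} {f : ι → Fn N}
    (hf : ∀ i ∈ s, ContDiff ℝ ∞ (f i)) : ContDiff ℝ ∞ (∑ i ∈ s, f i) := by
  have := ContDiff.sum hf
  convert this using 1
  funext ξ; simp

theorem contDiff_coord (μ : Idx N) : ContDiff ℝ ∞ (fun ξ : Phase N => ξ μ) := by fun_prop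

/-- The contribution of a product with a coordinate to a partial derivative. -/
theorem pd_coord_mul {u : Fn N} (hu : ContDiff ℝ ∞ u) (σ μ : Idx N) (ξ : Phase N) :
    pd σ ((fun ζ => ζ μ) * u) ξ = (if σ = μ then u ξ else 0) + ξ μ * pd σ u ξ := by
  rw [pd_mul (contDiff_coord μ) hu]
  simp only [Pi.add_apply, Pi.mul_apply, pd_coord]
  split_ifs <;> simp

end PartialDerivatives

/-! ### Differentiation under the integral sign. -/

section ParametricIntegral

/-- The derivative in `x` is jointly continuous, hence bounded on the compact product of a closed
unit ball and `[0, 1]`; that bound is the dominating function. -/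
theorem hasFDerivAt_intervalIntegral_of_contDiff {E : Type*} [NormedAddCommGroup E]
    [NormedSpace ℝ E] [ProperSpace E] {H : E → ℝ → ℝ}
    (hH : ContDiff ℝ ∞ (Function.uncurry H)) (x₀ : E) :
    HasFDerivAt (fun x => ∫ t in (0 : ℝ)..1, H x t)
      (∫ t in (0 : ℝ)..1, fderiv ℝ (fun x => H x t) x₀) x₀ := by
  have hc : Continuous fun q : E × ℝ => fderiv ℝ (fun x => H x q.2) q.1 := by
    have h1 : ContDiff ℝ ∞ (Function.uncurry fun (q : E × ℝ) (x : E) => H x q.2) :=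
      hH.comp (contDiff_snd.prodMk (contDiff_snd.comp contDiff_fst))
    have h2 : ContDiff ℝ ∞ fun q : E × ℝ => fderiv ℝ (fun x => H x q.2) q.1 :=
      h1.fderiv contDiff_fst (by simp)
    exact h2.continuous
  have hHc : Continuous (Function.uncurry H) := hH.continuous
  obtain ⟨C, hC⟩ := ((isCompact_closedBall x₀ 1).prod
    (isCompact_Icc (a := (0 : ℝ)) (b := 1))).exists_bound_of_continuousOn hc.continuousOn
  refine intervalIntegral.hasFDerivAt_integral_of_dominated_of_fderiv_le
    (F' := fun x t => fderiv ℝ (fun x => H x t) x) (bound := fun _ => C)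
    (Metric.closedBall_mem_nhds x₀ one_pos) ?_ ?_ ?_ ?_ ?_ ?_
  · refine Filter.Eventually.of_forall fun x => Continuous.aestronglyMeasurable ?_
    exact hHc.comp (by fun_prop : Continuous fun t : ℝ => (x, t))
  · exact (hHc.comp (by fun_prop : Continuous fun t : ℝ => (x₀, t))).intervalIntegrable _ _
  · exact (hc.comp (by fun_prop : Continuous fun t : ℝ => (x₀, t))).aestronglyMeasurable
  · refine Filter.Eventually.of_forall fun t ht x hx => hC (x, t) ⟨hx, ?_⟩
    rw [Set.uIoc_of_le zero_le_one] at ht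
    exact ⟨ht.1.le, ht.2⟩
  · exact continuous_const.intervalIntegrable _ _
  · refine Filter.Eventually.of_forall fun t _ x _ => ?_
    have h2 : ContDiff ℝ ∞ (fun x => H x t) :=
      hH.comp (contDiff_id.prodMk contDiff_const)
    exact (h2.differentiable (by simp) x).hasFDerivAt

end ParametricIntegral

/-! ### Partial scalings of phase space and weighted averages along them. -/

noncomputable section Scaling

/-- The part of a phase space point in the coordinate directions listed by `ι`. -/
def part (ι : Fin N → Idx N) : Phase N →L[ℝ] Phase N :=
  ∑ k, (ContinuousLinearMap.proj (R := ℝ) (φ := fun _ : Idx N => ℝ) (ι k)).smulRight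
    (Pi.single (ι k) 1)

theorem part_apply (ι : Fin N → Idx N) (ξ : Phase N) :
    part ι ξ = ∑ k, ξ (ι k) • Pi.single (ι k) (1 : ℝ) := by
  simp [part]

theorem part_single {ι : Fin N → Idx N} (hι : Function.Injective ι) (k : Fin N) :
    part ι (Pi.single (ι k) 1) = Pi.single (ι k) 1 := by
  rw [part_apply, Finset.sum_eq_single k]
  · simp
  · intro j _ hj
    rw [Pi.single_eq_of_ne (fun h => hj (hι h)), zero_smul]
  · simp

theorem part_single_of_notMem {ι : Fin N → Idx N} {σ : Idx N} (hσ : ∀ k, ι k ≠ σ) :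
    part ι (Pi.single σ 1) = 0 := by
  rw [part_apply]
  refine Finset.sum_eq_zero fun j _ => ?_
  rw [Pi.single_eq_of_ne (hσ j), zero_smul]

/-- Scaling of the coordinates listed by `ι` by the factor `s`. -/
def scale (ι : Fin N → Idx N) (s : ℝ) (ξ : Phase N) : Phase N := ξ + (s - 1) • part ι ξ

theorem scale_one (ι : Fin N → Idx N) (ξ : Phase N) : scale ι 1 ξ = ξ := by simp [scale]

theorem part_apply_of_mem {ι : Fin N → Idx N} (hι : Function.Injective ι) (ξ : Phase N)
    (k : Fin N) : part ι ξ (ι k) = ξ (ι k) := by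
  rw [part_apply, Finset.sum_apply, Finset.sum_eq_single k]
  · simp
  · intro j _ hj
    rw [Pi.smul_apply, Pi.single_eq_of_ne (fun h => hj (hι h.symm)), smul_zero]
  · simp

theorem part_apply_of_notMem {ι : Fin N → Idx N} (ξ : Phase N) {σ : Idx N}
    (hσ : ∀ k, ι k ≠ σ) : part ι ξ σ = 0 := by
  rw [part_apply, Finset.sum_apply]
  refine Finset.sum_eq_zero fun j _ => ?_
  rw [Pi.smul_apply, Pi.single_eq_of_ne (fun h => hσ j h.symm), smul_zero]

theorem scale_apply_of_mem {ι : Fin N → Idx N} (hι : Function.Injective ι) (s : ℝ)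
    (ξ : Phase N) (k : Fin N) : scale ι s ξ (ι k) = s * ξ (ι k) := by
  simp only [scale, Pi.add_apply, Pi.smul_apply, smul_eq_mul, part_apply_of_mem hι]
  ring

theorem scale_apply_of_notMem {ι : Fin N → Idx N} (s : ℝ)
    (ξ : Phase N) {σ : Idx N} (hσ : ∀ k, ι k ≠ σ) : scale ι s ξ σ = ξ σ := by
  simp [scale, part_apply_of_notMem ξ hσ]

theorem scaleX_eq (s : ℝ) (ξ : Phase N) : scaleX s ξ = scale Sum.inl s ξ := by
  funext σ
  rcases σ with i | i
  · rw [scale_apply_of_mem Sum.inl_injective]; rfl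
  · rw [scale_apply_of_notMem _ _ (by simp)]; rfl

theorem scaleP_eq (s : ℝ) (ξ : Phase N) : scaleP s ξ = scale Sum.inr s ξ := by
  funext σ
  rcases σ with i | i
  · rw [scale_apply_of_notMem _ _ (by simp)]; rfl
  · rw [scale_apply_of_mem Sum.inr_injective]; rfl

theorem contDiff_scale (ι : Fin N → Idx N) :
    ContDiff ℝ ∞ (fun q : Phase N × ℝ => scale ι q.2 q.1) := by
  unfold scale
  exact contDiff_fst.add ((contDiff_snd.sub contDiff_const).smul
    ((part ι).contDiff.comp contDiff_fst))

theorem contDiff_comp_scale {u : Fn N} (hu : ContDiff ℝ ∞ u) (ι : Fin N → Idx N) (s : ℝ) :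
    ContDiff ℝ ∞ (fun ξ => u (scale ι s ξ)) :=
  hu.comp ((contDiff_scale ι).comp (contDiff_id.prodMk contDiff_const))

theorem fderiv_comp_scale {u : Fn N} (hu : ContDiff ℝ ∞ u) (ι : Fin N → Idx N) (s : ℝ)
    (ξ v : Phase N) :
    fderiv ℝ (fun ζ => u (scale ι s ζ)) ξ v = fderiv ℝ u (scale ι s ξ) (scale ι s v) := by
  have h1 : HasFDerivAt (fun ζ => scale ι s ζ)
      (ContinuousLinearMap.id ℝ (Phase N) + (s - 1) • part ι) ξ :=
    (hasFDerivAt_id ξ).add ((part ι).hasFDerivAt.const_smul (s - 1))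
  have h2 := (smooth_differentiable hu (scale ι s ξ)).hasFDerivAt.comp ξ h1
  change HasFDerivAt (fun ζ => u (scale ι s ζ)) _ ξ at h2
  rw [h2.fderiv]
  simp [scale]

theorem scale_single {ι : Fin N → Idx N} (hι : Function.Injective ι) (s : ℝ) (k : Fin N) :
    scale ι s (Pi.single (ι k) 1) = s • Pi.single (ι k) 1 := by
  rw [scale, part_single hι, sub_smul, one_smul, add_sub_cancel]

theorem scale_single_of_notMem {ι : Fin N → Idx N} (s : ℝ) {σ : Idx N} (hσ : ∀ k, ι k ≠ σ) :
    scale ι s (Pi.single σ 1) = Pi.single σ 1 := by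
  rw [scale, part_single_of_notMem hσ, smul_zero, add_zero]

theorem pd_comp_scale {u : Fn N} (hu : ContDiff ℝ ∞ u) {ι : Fin N → Idx N}
    (hι : Function.Injective ι) (s : ℝ) (k : Fin N) (ξ : Phase N) :
    pd (ι k) (fun ζ => u (scale ι s ζ)) ξ = s * pd (ι k) u (scale ι s ξ) := by
  rw [pd, fderiv_comp_scale hu, scale_single hι, map_smul, smul_eq_mul]
  rfl

theorem pd_comp_scale_of_notMem {u : Fn N} (hu : ContDiff ℝ ∞ u) {ι : Fin N → Idx N}
    (s : ℝ) {σ : Idx N} (hσ : ∀ k, ι k ≠ σ) (ξ : Phase N) :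
    pd σ (fun ζ => u (scale ι s ζ)) ξ = pd σ u (scale ι s ξ) := by
  rw [pd, fderiv_comp_scale hu, scale_single_of_notMem s hσ]
  rfl

/-- The weighted average `∫₀¹ s^m u(scale ι s ξ) ds`. -/
def avg (ι : Fin N → Idx N) (m : ℕ) (u : Fn N) : Fn N := fun ξ =>
  ∫ s in (0 : ℝ)..1, s ^ m * u (scale ι s ξ)

theorem contDiff_avg_integrand {u : Fn N} (hu : ContDiff ℝ ∞ u) (ι : Fin N → Idx N) (m : ℕ) :
    ContDiff ℝ ∞ (Function.uncurry fun (ξ : Phase N) (s : ℝ) => s ^ m * u (scale ι s ξ)) :=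
  (contDiff_snd.pow m).mul (hu.comp (contDiff_scale ι))

theorem hasFDerivAt_avg {u : Fn N} (hu : ContDiff ℝ ∞ u) (ι : Fin N → Idx N) (m : ℕ)
    (ξ : Phase N) :
    HasFDerivAt (avg ι m u)
      (∫ s in (0 : ℝ)..1, fderiv ℝ (fun ζ => s ^ m * u (scale ι s ζ)) ξ) ξ :=
  hasFDerivAt_intervalIntegral_of_contDiff (contDiff_avg_integrand hu ι m) ξ

theorem pd_avg_eq {u : Fn N} (hu : ContDiff ℝ ∞ u) (ι : Fin N → Idx N) (m : ℕ)
    (σ : Idx N) (ξ : Phase N) :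
    pd σ (avg ι m u) ξ = ∫ s in (0 : ℝ)..1, s ^ m * pd σ (fun ζ => u (scale ι s ζ)) ξ := by
  have hc : Continuous fun s : ℝ => fderiv ℝ (fun ζ => s ^ m * u (scale ι s ζ)) ξ := by
    have h1 : ContDiff ℝ ∞ (Function.uncurry fun (s : ℝ) (ζ : Phase N) =>
        s ^ m * u (scale ι s ζ)) :=
      (contDiff_avg_integrand hu ι m).comp (contDiff_snd.prodMk contDiff_fst)
    have h2 : ContDiff ℝ ∞ fun s : ℝ => fderiv ℝ (fun ζ => s ^ m * u (scale ι s ζ)) ξ :=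
      h1.fderiv contDiff_const (by simp)
    exact h2.continuous
  rw [pd, (hasFDerivAt_avg hu ι m ξ).fderiv,
    ContinuousLinearMap.intervalIntegral_apply (hc.intervalIntegrable _ _)]
  refine intervalIntegral.integral_congr fun s _ => ?_
  simp only [pd]
  rw [fderiv_const_mul (smooth_differentiable (contDiff_comp_scale hu ι s) ξ)]
  rfl

theorem pd_avg {u : Fn N} (hu : ContDiff ℝ ∞ u) {ι : Fin N → Idx N}
    (hι : Function.Injective ι) (m : ℕ) (k : Fin N) :
    pd (ι k) (avg ι m u) = avg ι (m + 1) (pd (ι k) u) := by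
  funext ξ
  rw [pd_avg_eq hu]
  refine intervalIntegral.integral_congr fun s _ => ?_
  simp only [pd_comp_scale hu hι]
  ring

theorem pd_avg_of_notMem {u : Fn N} (hu : ContDiff ℝ ∞ u) {ι : Fin N → Idx N}
    (m : ℕ) {σ : Idx N} (hσ : ∀ k, ι k ≠ σ) :
    pd σ (avg ι m u) = avg ι m (pd σ u) := by
  funext ξ
  rw [pd_avg_eq hu]
  refine intervalIntegral.integral_congr fun s _ => ?_
  simp only [pd_comp_scale_of_notMem hu s hσ]

/-- A partial derivative of an average is again an average of a smooth function, with the weight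
raised by one in the scaled directions. The induction on the differentiability order must therefore
vary both `m` and `u`. -/
theorem contDiff_avg {u : Fn N} (hu : ContDiff ℝ ∞ u) {ι : Fin N → Idx N}
    (hι : Function.Injective ι) (m : ℕ) : ContDiff ℝ ∞ (avg ι m u) := by
  refine contDiff_infty.2 fun n => ?_
  induction n generalizing m u with
  | zero =>
    refine contDiff_zero.2 (continuous_iff_continuousAt.2 fun ξ => ?_)
    exact (hasFDerivAt_avg hu ι m ξ).continuousAt
  | succ n ih =>
    rw [Nat.cast_succ, contDiff_succ_iff_fderiv_apply]
    refine ⟨fun ξ => (hasFDerivAt_avg hu ι m ξ).differentiableAt, by simp, fun v => ?_⟩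
    simp only [fderiv_apply_eq_sum_pd]
    refine ContDiff.sum fun σ _ => contDiff_const.mul ?_
    by_cases hσ : ∃ k, ι k = σ
    · obtain ⟨k, rfl⟩ := hσ
      rw [pd_avg hu hι]
      exact ih (contDiff_pd hu _) _
    · push Not at hσ
      rw [pd_avg_of_notMem hu m hσ]
      exact ih (contDiff_pd hu _) _

theorem avg_integrable {u : Fn N} (hu : ContDiff ℝ ∞ u) (ι : Fin N → Idx N) (m : ℕ)
    (ξ : Phase N) :
    IntervalIntegrable (fun s => s ^ m * u (scale ι s ξ)) MeasureTheory.volume 0 1 :=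
  ((contDiff_avg_integrand hu ι m).continuous.comp
    (by fun_prop : Continuous fun s : ℝ => (ξ, s))).intervalIntegrable _ _

theorem avg_add {u v : Fn N} (hu : ContDiff ℝ ∞ u) (hv : ContDiff ℝ ∞ v) (ι : Fin N → Idx N)
    (m : ℕ) (ξ : Phase N) : avg ι m (u + v) ξ = avg ι m u ξ + avg ι m v ξ := by
  rw [avg, avg, avg, ← intervalIntegral.integral_add (avg_integrable hu ι m ξ)
    (avg_integrable hv ι m ξ)]
  simp only [Pi.add_apply, mul_add]

theorem avg_neg (u : Fn N) (ι : Fin N → Idx N) (m : ℕ) (ξ : Phase N) :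
    avg ι m (-u) ξ = -avg ι m u ξ := by
  simp [avg]

theorem avg_sub {u v : Fn N} (hu : ContDiff ℝ ∞ u) (hv : ContDiff ℝ ∞ v) (ι : Fin N → Idx N)
    (m : ℕ) (ξ : Phase N) : avg ι m (u - v) ξ = avg ι m u ξ - avg ι m v ξ := by
  rw [sub_eq_add_neg, avg_add hu (smooth_neg hv), avg_neg, sub_eq_add_neg]

theorem hasDerivAt_comp_scale {u : Fn N} (hu : ContDiff ℝ ∞ u) (ι : Fin N → Idx N)
    (ξ : Phase N) (s : ℝ) :
    HasDerivAt (fun s => u (scale ι s ξ)) (∑ k, ξ (ι k) * pd (ι k) u (scale ι s ξ)) s := by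
  have h1 : HasDerivAt (fun s => scale ι s ξ) (part ι ξ) s := by
    have := (((hasDerivAt_id s).sub_const 1).smul_const (part ι ξ)).const_add ξ
    simpa [scale] using this
  have h2 := (smooth_differentiable hu (scale ι s ξ)).hasFDerivAt.comp_hasDerivAt s h1
  refine h2.congr_deriv ?_
  rw [part_apply, map_sum]
  simp [pd]

theorem integral_sum_mul {ι : Fin N → Idx N} {u : Fin N → Fn N}
    (hu : ∀ k, ContDiff ℝ ∞ (u k)) (m : ℕ) (ξ : Phase N) (c : Fin N → ℝ) :
    ∫ s in (0 : ℝ)..1, s ^ m * ∑ k, c k * u k (scale ι s ξ) = ∑ k, c k * avg ι m (u k) ξ := by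
  simp only [avg, ← intervalIntegral.integral_const_mul]
  rw [← intervalIntegral.integral_finsetSum
    fun k _ => (avg_integrable (hu k) ι m ξ).const_mul (c k)]
  refine intervalIntegral.integral_congr fun s _ => ?_
  simp only [Finset.mul_sum]
  exact Finset.sum_congr rfl fun k _ => by ring

/-- The fundamental theorem of calculus along the scaling. -/
theorem sub_scale_zero_eq {u : Fn N} (hu : ContDiff ℝ ∞ u) (ι : Fin N → Idx N) (ξ : Phase N) :
    u ξ - u (scale ι 0 ξ) = ∑ k, ξ (ι k) * avg ι 0 (pd (ι k) u) ξ := by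
  rw [← integral_sum_mul (fun k => contDiff_pd hu (ι k))]
  simp only [pow_zero, one_mul]
  rw [intervalIntegral.integral_eq_sub_of_hasDerivAt
    (fun s _ => hasDerivAt_comp_scale hu ι ξ s), scale_one]
  have : Continuous fun s : ℝ => ∑ k, ξ (ι k) * pd (ι k) u (scale ι s ξ) := by
    refine continuous_finsetSum _ fun k _ => continuous_const.mul ?_
    exact ((contDiff_pd hu (ι k)).comp (contDiff_scale ι)).continuous.comp
      (by fun_prop : Continuous fun s : ℝ => (ξ, s))
  exact this.intervalIntegrable _ _

/-- The weighted form of the fundamental theorem of calculus along the scaling. -/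
theorem eq_avg_add_sum {u : Fn N} (hu : ContDiff ℝ ∞ u) (ι : Fin N → Idx N) (m : ℕ)
    (ξ : Phase N) :
    u ξ = (m + 1) * avg ι m u ξ + ∑ k, ξ (ι k) * avg ι (m + 1) (pd (ι k) u) ξ := by
  have hi := avg_integrable hu ι m ξ
  have hi' : IntervalIntegrable
      (fun s : ℝ => s ^ (m + 1) * ∑ k, ξ (ι k) * pd (ι k) u (scale ι s ξ))
      MeasureTheory.volume 0 1 := by
    refine Continuous.intervalIntegrable ((continuous_pow _).mul ?_) _ _
    refine continuous_finsetSum _ fun k _ => continuous_const.mul ?_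
    exact ((contDiff_pd hu (ι k)).comp (contDiff_scale ι)).continuous.comp
      (by fun_prop : Continuous fun s : ℝ => (ξ, s))
  rw [← integral_sum_mul (fun k => contDiff_pd hu (ι k)), avg,
    ← intervalIntegral.integral_const_mul, ← intervalIntegral.integral_add
      (hi.const_mul _) hi']
  -- The factor `s ^ (m + 1)` kills the boundary term at `s = 0`.
  have hd : ∀ s : ℝ, HasDerivAt (fun s : ℝ => s ^ (m + 1) * u (scale ι s ξ))
      ((m + 1) * (s ^ m * u (scale ι s ξ))
        + s ^ (m + 1) * ∑ k, ξ (ι k) * pd (ι k) u (scale ι s ξ)) s := by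
    intro s
    refine ((hasDerivAt_pow (m + 1) s).mul (hasDerivAt_comp_scale hu ι ξ s)).congr_deriv ?_
    push_cast
    ring
  rw [intervalIntegral.integral_eq_sub_of_hasDerivAt (fun s _ => hd s)
    ((hi.const_mul _).add hi'), scale_one]
  simp

end Scaling

/-! ### Poincaré lemmas for one- and two-forms in half of the variables. -/

noncomputable section Poincare

variable {ι : Fin N → Idx N}

/-- The homotopy operator on one-forms in the directions `ι`. -/
def primitive (ι : Fin N → Idx N) (u : Fin N → Fn N) : Fn N :=
  ∑ k, (fun ξ => ξ (ι k)) * avg ι 0 (u k)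

theorem contDiff_primitive (hι : Function.Injective ι) {u : Fin N → Fn N}
    (hu : ∀ k, ContDiff ℝ ∞ (u k)) : ContDiff ℝ ∞ (primitive ι u) :=
  contDiff_finsetSum fun k _ => smooth_mul (contDiff_coord _) (contDiff_avg (hu k) hι 0)

theorem pd_sum_coord_mul {v : Fin N → Fn N} (hv : ∀ k, ContDiff ℝ ∞ (v k))
    (hι : Function.Injective ι) (i : Fin N) (ξ : Phase N) :
    pd (ι i) (∑ k, (fun ζ => ζ (ι k)) * v k) ξ = v i ξ + ∑ k, ξ (ι k) * pd (ι i) (v k) ξ := by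
  rw [pd_sum fun k _ => smooth_mul (contDiff_coord _) (hv k)]
  simp only [Finset.sum_apply, pd_coord_mul (hv _), Finset.sum_add_distrib, hι.eq_iff,
    Finset.sum_ite_eq, Finset.mem_univ, if_true]

theorem pd_sum_coord_mul_of_notMem {v : Fin N → Fn N} (hv : ∀ k, ContDiff ℝ ∞ (v k))
    {σ : Idx N} (hσ : ∀ k, ι k ≠ σ) :
    pd σ (∑ k, (fun ζ => ζ (ι k)) * v k) = ∑ k, (fun ζ => ζ (ι k)) * pd σ (v k) := by
  funext ξ
  rw [pd_sum fun k _ => smooth_mul (contDiff_coord _) (hv k)]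
  simp only [Finset.sum_apply, pd_coord_mul (hv _), (hσ _).symm, if_false, zero_add, Pi.mul_apply]

/-- Closedness turns `∂_i u_k` into `∂_k u_i`, so that the derivative is the right-hand side of
`eq_avg_add_sum` with `m = 0`. -/
theorem pd_primitive (hι : Function.Injective ι) {u : Fin N → Fn N}
    (hu : ∀ k, ContDiff ℝ ∞ (u k)) (hcl : ∀ i k, pd (ι i) (u k) = pd (ι k) (u i)) (i : Fin N) :
    pd (ι i) (primitive ι u) = u i := by
  funext ξ
  rw [primitive, pd_sum_coord_mul (fun k => contDiff_avg (hu k) hι 0) hι,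
    eq_avg_add_sum (hu i) ι 0 ξ]
  simp only [pd_avg (hu _) hι, hcl i]
  simp

theorem pd_primitive_of_notMem (hι : Function.Injective ι) {u : Fin N → Fn N}
    (hu : ∀ k, ContDiff ℝ ∞ (u k)) {σ : Idx N} (hσ : ∀ k, ι k ≠ σ) :
    pd σ (primitive ι u) = primitive ι fun k => pd σ (u k) := by
  rw [primitive, pd_sum_coord_mul_of_notMem (fun k => contDiff_avg (hu k) hι 0) hσ]
  simp only [pd_avg_of_notMem (hu _) 0 hσ, primitive]

theorem primitive_eq_zero (u : Fin N → Fn N) {ξ : Phase N} (hξ : ∀ k, ξ (ι k) = 0) :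
    primitive ι u ξ = 0 := by
  simp [primitive, Finset.sum_apply, hξ]

/-- The homotopy operator on two-forms in the directions `ι`. -/
def potential (ι : Fin N → Idx N) (w : Fin N → Fin N → Fn N) (j : Fin N) : Fn N :=
  ∑ k, (fun ξ => ξ (ι k)) * avg ι 1 (w k j)

theorem contDiff_potential (hι : Function.Injective ι) {w : Fin N → Fin N → Fn N}
    (hw : ∀ i j, ContDiff ℝ ∞ (w i j)) (j : Fin N) : ContDiff ℝ ∞ (potential ι w j) :=
  contDiff_finsetSum fun k _ => smooth_mul (contDiff_coord _) (contDiff_avg (hw k j) hι 1)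

/-- Each of the two derivatives contributes one copy of `avg ι 1 (w i j)`, and closedness collapses
the rest to `∑ ξ_k avg ι 2 (∂_k w_{ij})`. The sum is `eq_avg_add_sum` with `m = 1`, whose factor 2
explains the weight `s` in the homotopy. -/
theorem pd_potential_sub (hι : Function.Injective ι) {w : Fin N → Fin N → Fn N}
    (hw : ∀ i j, ContDiff ℝ ∞ (w i j)) (hanti : ∀ i j, w j i = -w i j)
    (hcl : ∀ i j k, pd (ι k) (w i j) + pd (ι i) (w j k) + pd (ι j) (w k i) = 0) (i j : Fin N) :
    pd (ι i) (potential ι w j) - pd (ι j) (potential ι w i) = w i j := by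
  funext ξ
  have hs : ∀ k, avg ι 2 (pd (ι i) (w k j)) ξ - avg ι 2 (pd (ι j) (w k i)) ξ
      = avg ι 2 (pd (ι k) (w i j)) ξ := by
    intro k
    rw [← avg_sub (contDiff_pd (hw _ _) _) (contDiff_pd (hw _ _) _)]
    congr 1
    have := hcl i j k
    rw [hanti k j, pd_neg] at this
    linear_combination (exp := 1) -this
  simp only [Pi.sub_apply, potential]
  rw [pd_sum_coord_mul (fun k => contDiff_avg (hw k j) hι 1) hι,
    pd_sum_coord_mul (fun k => contDiff_avg (hw k i) hι 1) hι, eq_avg_add_sum (hw i j) ι 1 ξ,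
    hanti i j, avg_neg]
  simp only [pd_avg (hw _ _) hι, Nat.reduceAdd]
  rw [← Finset.sum_congr rfl fun k _ => congrArg (ξ (ι k) * ·) (hs k)]
  simp only [mul_sub, Finset.sum_sub_distrib]
  push_cast
  ring

theorem potential_apply {w : Fin N → Fin N → Fn N} (hw : ∀ i j, ContDiff ℝ ∞ (w i j))
    (j : Fin N) (ξ : Phase N) :
    potential ι w j ξ
      = ∫ s in (0 : ℝ)..1, (∑ k, ξ (ι k) * w k j (scale ι s ξ)) * s := by
  have := integral_sum_mul (ι := ι) (fun k => hw k j) 1 ξ (fun k => ξ (ι k))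
  simp only [potential, Finset.sum_apply, Pi.mul_apply]
  rw [← this]
  refine intervalIntegral.integral_congr fun s _ => ?_
  simp only [pow_one]
  ring

/-- A smooth function with vanishing derivatives in the directions `ι` does not depend on them. -/
theorem eq_scale_zero_of_pd_eq_zero {u : Fn N} (hu : ContDiff ℝ ∞ u)
    (h : ∀ k, pd (ι k) u = 0) (ξ : Phase N) : u ξ = u (scale ι 0 ξ) := by
  have := sub_scale_zero_eq hu ι ξ
  simp only [h] at this
  simpa [avg, sub_eq_zero] using this

end Poincare

/-! ### The Darboux equation in a fixed order. -/

noncomputable section FixedOrder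

/-- The derivation `Ω⁰_{μσ} ∂_σ`. -/
def hamDeriv (μ : Idx N) (f : Fn N) : Fn N :=
  Sum.elim (fun i => pd (Sum.inr i) f) (fun i => -pd (Sum.inl i) f) μ

@[simp] theorem hamDeriv_inl (i : Fin N) (f : Fn N) :
    hamDeriv (Sum.inl i) f = pd (Sum.inr i) f := rfl

@[simp] theorem hamDeriv_inr (i : Fin N) (f : Fn N) :
    hamDeriv (Sum.inr i) f = -pd (Sum.inl i) f := rfl

theorem sum_Omega0_mul (μ : Idx N) (v : Idx N → ℝ) :
    ∑ σ, Omega0 N μ σ * v σ = Sum.elim (fun i => v (Sum.inr i)) (fun i => -v (Sum.inl i)) μ := by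
  rcases μ with i | i <;> simp [Omega0, Fintype.sum_sum_type, Matrix.one_apply]

theorem Omega0_antisymm (μ ν : Idx N) : Omega0 N ν μ = -Omega0 N μ ν := by
  rcases μ with i | i <;> rcases ν with j | j <;> simp [Omega0, Matrix.one_apply, eq_comm]

theorem sum_Omega0_mul_pd (μ : Idx N) (f : Fn N) (ξ : Phase N) :
    ∑ σ, Omega0 N μ σ * pd σ f ξ = hamDeriv μ f ξ := by
  rw [sum_Omega0_mul]
  rcases μ with i | i <;> rfl

theorem sum_pd_mul_Omega0 (μ : Idx N) (f : Fn N) (ξ : Phase N) :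
    ∑ σ, pd σ f ξ * Omega0 N σ μ = -hamDeriv μ f ξ := by
  rw [← sum_Omega0_mul_pd, ← Finset.sum_neg_distrib]
  exact Finset.sum_congr rfl fun σ _ => by rw [Omega0_antisymm]; ring

theorem contDiff_hamDeriv {f : Fn N} (hf : ContDiff ℝ ∞ f) (μ : Idx N) :
    ContDiff ℝ ∞ (hamDeriv μ f) := by
  rcases μ with i | i
  · exact contDiff_pd hf _
  · exact (contDiff_pd hf _).neg

theorem hamDeriv_comm {f : Fn N} (hf : ContDiff ℝ ∞ f) (μ ν : Idx N) :
    hamDeriv μ (hamDeriv ν f) = hamDeriv ν (hamDeriv μ f) := by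
  rcases μ with i | i <;> rcases ν with j | j <;> simp [pd_comm hf]

theorem hamDeriv_sub {f g : Fn N} (hf : ContDiff ℝ ∞ f) (hg : ContDiff ℝ ∞ g) (μ : Idx N) :
    hamDeriv μ (f - g) = hamDeriv μ f - hamDeriv μ g := by
  rcases μ with i | i <;> simp [pd_sub hf hg]
  abel

/-- Antisymmetry of `Ω⁰` makes the equation an exactness statement for the commuting derivations
`hamDeriv`. -/
theorem darbouxEq_iff {F : Idx N → Idx N → Fn N} {e : Idx N → Fn N} :
    DarbouxEq F e ↔ ∀ μ ν, F μ ν = hamDeriv ν (e μ) - hamDeriv μ (e ν) := by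
  simp only [DarbouxEq, sum_Omega0_mul_pd, sum_pd_mul_Omega0, funext_iff, Pi.sub_apply]
  refine forall_congr' fun μ => forall_congr' fun ν => forall_congr' fun ξ => ?_
  constructor <;> intro h <;> linarith

theorem cyclicDeriv_eq (F : Idx N → Idx N → Fn N) (α μ ν : Idx N) :
    cyclicDeriv F α μ ν = hamDeriv α (F μ ν) + hamDeriv μ (F ν α) + hamDeriv ν (F α μ) := by
  funext ξ
  simp only [cyclicDeriv, Finset.sum_add_distrib, sum_Omega0_mul_pd, Pi.add_apply]

theorem integrability_iff {F : Idx N → Idx N → Fn N} :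
    Integrability F ↔ ∀ α μ ν,
      hamDeriv α (F μ ν) + hamDeriv μ (F ν α) + hamDeriv ν (F α μ) = 0 := by
  simp only [Integrability, cyclicDeriv_eq, funext_iff, Pi.zero_apply]

/-- Exact implies closed: the six second derivatives cancel in pairs. -/
theorem DarbouxEq.integrability {F : Idx N → Idx N → Fn N} {e : Idx N → Fn N}
    (he : ∀ μ, ContDiff ℝ ∞ (e μ)) (h : DarbouxEq F e) : Integrability F := by
  rw [darbouxEq_iff] at h
  rw [integrability_iff]
  intro α μ ν
  simp only [h, hamDeriv_sub (contDiff_hamDeriv (he _) _) (contDiff_hamDeriv (he _) _),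
    hamDeriv_comm (he α) μ ν, hamDeriv_comm (he μ) α ν, hamDeriv_comm (he ν) α μ]
  abel

/-- The part of the `y`-components that does not involve `f`. -/
def yPart (F : Idx N → Idx N → Fn N) : Fin N → Fn N :=
  potential Sum.inr fun k j => F (Sum.inl j) (Sum.inl k)

/-- The part of the `π`-components that does not involve `g`. -/
def piPart (F : Idx N → Idx N → Fn N) : Fin N → Fn N :=
  potential Sum.inl fun k j => F (Sum.inr k) (Sum.inr j)

/-- The mixed second derivative of `f + g` prescribed by the mixed relation. -/
def mixedPart (F : Idx N → Idx N → Fn N) (i j : Fin N) : Fn N :=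
  F (Sum.inr i) (Sum.inl j) - pd (Sum.inl i) (yPart F j) - pd (Sum.inr j) (piPart F i)

variable {F : Idx N → Idx N → Fn N}

theorem contDiff_yPart (hF : ∀ μ ν, ContDiff ℝ ∞ (F μ ν)) (i : Fin N) :
    ContDiff ℝ ∞ (yPart F i) :=
  contDiff_potential Sum.inr_injective (fun _ _ => hF _ _) i

theorem contDiff_piPart (hF : ∀ μ ν, ContDiff ℝ ∞ (F μ ν)) (i : Fin N) :
    ContDiff ℝ ∞ (piPart F i) :=
  contDiff_potential Sum.inl_injective (fun _ _ => hF _ _) i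

theorem contDiff_mixedPart (hF : ∀ μ ν, ContDiff ℝ ∞ (F μ ν)) (i j : Fin N) :
    ContDiff ℝ ∞ (mixedPart F i j) :=
  ((hF _ _).sub (contDiff_pd (contDiff_yPart hF j) _)).sub
    (contDiff_pd (contDiff_piPart hF i) _)

/-- Integrability with three position indices is closedness of the block `F_{ij}` as a two-form in
`p`, with `x` as a parameter. -/
theorem pd_yPart_sub (hF : ∀ μ ν, ContDiff ℝ ∞ (F μ ν)) (hanti : ∀ μ ν, F ν μ = -F μ ν)
    (hI : Integrability F) (i j : Fin N) :
    pd (Sum.inr j) (yPart F i) - pd (Sum.inr i) (yPart F j) = F (Sum.inl i) (Sum.inl j) := by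
  refine pd_potential_sub Sum.inr_injective (fun _ _ => hF _ _) (fun _ _ => hanti _ _) ?_ j i
  intro a b c
  have h := integrability_iff.1 hI (Sum.inl c) (Sum.inl b) (Sum.inl a)
  simp only [hamDeriv_inl] at h
  rw [← h]
  abel

/-- The same with three momentum indices and the roles of `x` and `p` exchanged; the common sign of
the derivations `-∂_x` drops out of closedness. -/
theorem pd_piPart_sub (hF : ∀ μ ν, ContDiff ℝ ∞ (F μ ν)) (hanti : ∀ μ ν, F ν μ = -F μ ν)
    (hI : Integrability F) (i j : Fin N) :
    pd (Sum.inl i) (piPart F j) - pd (Sum.inl j) (piPart F i) = F (Sum.inr i) (Sum.inr j) := by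
  refine pd_potential_sub Sum.inl_injective (fun _ _ => hF _ _) (fun _ _ => hanti _ _) ?_ i j
  intro a b c
  have h := integrability_iff.1 hI (Sum.inr c) (Sum.inr a) (Sum.inr b)
  simp only [hamDeriv_inr] at h
  rw [← neg_eq_zero, ← h]
  abel

/-- After antisymmetrization in `i, k` the `yPart` terms cancel, and `pd_piPart_sub` converts the
`piPart` terms into `∂_{p_j} F_{N+k,N+i}`. What remains is integrability with two momentum indices
and one position index. -/
theorem pd_inl_mixedPart (hF : ∀ μ ν, ContDiff ℝ ∞ (F μ ν)) (hanti : ∀ μ ν, F ν μ = -F μ ν)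
    (hI : Integrability F) (i j k : Fin N) :
    pd (Sum.inl k) (mixedPart F i j) = pd (Sum.inl i) (mixedPart F k j) := by
  have hY := contDiff_yPart hF
  have hP := contDiff_piPart hF
  have h := integrability_iff.1 hI (Sum.inr k) (Sum.inr i) (Sum.inl j)
  have h2 := congrArg (pd (Sum.inr j)) (pd_piPart_sub hF hanti hI k i)
  rw [pd_sub (contDiff_pd (hP _) _) (contDiff_pd (hP _) _)] at h2
  have h3 := hanti (Sum.inr k) (Sum.inl j)
  simp only [hamDeriv_inl, hamDeriv_inr, h3, pd_neg] at h
  simp only [mixedPart]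
  rw [pd_sub (smooth_sub (hF _ _) (contDiff_pd (hY _) _)) (contDiff_pd (hP _) _),
    pd_sub (smooth_sub (hF _ _) (contDiff_pd (hY _) _)) (contDiff_pd (hP _) _),
    pd_sub (hF _ _) (contDiff_pd (hY _) _), pd_sub (hF _ _) (contDiff_pd (hY _) _),
    pd_comm (hY j) (Sum.inl k), pd_comm (hP i) (Sum.inl k), pd_comm (hP k) (Sum.inl i)]
  linear_combination (exp := 1) -h - h2

/-- Mirror image of the preceding argument: here the `piPart` terms cancel and `pd_yPart_sub` is
used. -/
theorem pd_inr_mixedPart (hF : ∀ μ ν, ContDiff ℝ ∞ (F μ ν)) (hanti : ∀ μ ν, F ν μ = -F μ ν)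
    (hI : Integrability F) (i j k : Fin N) :
    pd (Sum.inr k) (mixedPart F i j) = pd (Sum.inr j) (mixedPart F i k) := by
  have hY := contDiff_yPart hF
  have hP := contDiff_piPart hF
  have h := integrability_iff.1 hI (Sum.inr i) (Sum.inl j) (Sum.inl k)
  have h2 := congrArg (pd (Sum.inl i)) (pd_yPart_sub hF hanti hI j k)
  rw [pd_sub (contDiff_pd (hY _) _) (contDiff_pd (hY _) _)] at h2
  simp only [hamDeriv_inl, hamDeriv_inr, hanti (Sum.inr i) (Sum.inl k), pd_neg] at h
  simp only [mixedPart]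
  rw [pd_sub (smooth_sub (hF _ _) (contDiff_pd (hY _) _)) (contDiff_pd (hP _) _),
    pd_sub (smooth_sub (hF _ _) (contDiff_pd (hY _) _)) (contDiff_pd (hP _) _),
    pd_sub (hF _ _) (contDiff_pd (hY _) _), pd_sub (hF _ _) (contDiff_pd (hY _) _),
    pd_comm (hP i) (Sum.inr k), pd_comm (hY j) (Sum.inr k), pd_comm (hY k) (Sum.inr j)]
  linear_combination (exp := 1) h - h2

theorem integralSol_inl (hF : ∀ μ ν, ContDiff ℝ ∞ (F μ ν)) (f g : Fn N) (i : Fin N) :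
    integralSol F f g (Sum.inl i) = yPart F i + pd (Sum.inr i) f := by
  funext ξ
  simp only [integralSol, Sum.elim_inl, Pi.add_apply, yPart, scaleP_eq]
  rw [potential_apply (fun _ _ => hF _ _)]

theorem integralSol_inr (hF : ∀ μ ν, ContDiff ℝ ∞ (F μ ν)) (f g : Fn N) (i : Fin N) :
    integralSol F f g (Sum.inr i) = piPart F i + pd (Sum.inl i) g := by
  funext ξ
  simp only [integralSol, Sum.elim_inr, Pi.add_apply, piPart, scaleX_eq]
  rw [potential_apply (fun _ _ => hF _ _)]

theorem contDiff_integralSol (hF : ∀ μ ν, ContDiff ℝ ∞ (F μ ν)) {f g : Fn N}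
    (hf : ContDiff ℝ ∞ f) (hg : ContDiff ℝ ∞ g) (μ : Idx N) :
    ContDiff ℝ ∞ (integralSol F f g μ) := by
  rcases μ with i | i
  · rw [integralSol_inl hF]
    exact (contDiff_yPart hF i).add (contDiff_pd hf _)
  · rw [integralSol_inr hF]
    exact (contDiff_piPart hF i).add (contDiff_pd hg _)

theorem mixedRelation_iff_pd {f g : Fn N} : MixedRelation F f g ↔ ∀ i j,
    pd (Sum.inl i) (integralSol F f g (Sum.inl j))
      + pd (Sum.inr j) (integralSol F f g (Sum.inr i)) = F (Sum.inr i) (Sum.inl j) := by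
  simp only [MixedRelation, funext_iff, Pi.add_apply]

/-- The two pure blocks hold for any `f` and `g`, since gradients drop out by symmetry of second
derivatives. Only the mixed block is a condition. -/
theorem darbouxEq_integralSol_iff (hF : ∀ μ ν, ContDiff ℝ ∞ (F μ ν))
    (hanti : ∀ μ ν, F ν μ = -F μ ν) (hI : Integrability F) {f g : Fn N}
    (hf : ContDiff ℝ ∞ f) (hg : ContDiff ℝ ∞ g) :
    DarbouxEq F (integralSol F f g) ↔ MixedRelation F f g := by
  rw [darbouxEq_iff, mixedRelation_iff_pd]
  constructor
  · intro h i j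
    rw [h (Sum.inr i) (Sum.inl j)]
    simp only [hamDeriv_inl, hamDeriv_inr]
    abel
  · intro h μ ν
    rcases μ with i | i <;> rcases ν with j | j
    · rw [integralSol_inl hF, integralSol_inl hF, ← pd_yPart_sub hF hanti hI i j, hamDeriv_inl,
        hamDeriv_inl, pd_add (contDiff_yPart hF i) (contDiff_pd hf _),
        pd_add (contDiff_yPart hF j) (contDiff_pd hf _), pd_comm hf (Sum.inr j)]
      abel
    · rw [hanti (Sum.inr j) (Sum.inl i), ← h j i]
      simp only [hamDeriv_inl, hamDeriv_inr]
      abel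
    · rw [← h i j]
      simp only [hamDeriv_inl, hamDeriv_inr]
      abel
    · rw [integralSol_inr hF, integralSol_inr hF, ← pd_piPart_sub hF hanti hI i j, hamDeriv_inr,
        hamDeriv_inr, pd_add (contDiff_piPart hF i) (contDiff_pd hg _),
        pd_add (contDiff_piPart hF j) (contDiff_pd hg _), pd_comm hg (Sum.inl j)]
      abel

/-- Only the sum `f + g` is constrained, which is why the normalization is imposed on it. -/
theorem mixedRelation_iff (hF : ∀ μ ν, ContDiff ℝ ∞ (F μ ν)) {f g : Fn N}
    (hf : ContDiff ℝ ∞ f) (hg : ContDiff ℝ ∞ g) :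
    MixedRelation F f g ↔
      ∀ i j, pd (Sum.inl i) (pd (Sum.inr j) (f + g)) = mixedPart F i j := by
  rw [mixedRelation_iff_pd]
  refine forall_congr' fun i => forall_congr' fun j => ?_
  rw [integralSol_inl hF, integralSol_inr hF, mixedPart,
    pd_add (contDiff_yPart hF j) (contDiff_pd hf _),
    pd_add (contDiff_piPart hF i) (contDiff_pd hg _), pd_add hf hg,
    pd_add (contDiff_pd hf _) (contDiff_pd hg _), pd_comm hg (Sum.inl i)]
  constructor <;> intro h
  · rw [← h]; abel
  · linear_combination (exp := 1) h

/-- Vanishing at all points with `x = 0` or `p = 0`. -/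
def VanishesOnAxes (h : Fn N) : Prop :=
  ∀ ξ : Phase N, ((∀ i, ξ (Sum.inl i) = 0) ∨ (∀ i, ξ (Sum.inr i) = 0)) → h ξ = 0

theorem normalized_iff {f g : Fn N} : Normalized f g ↔ VanishesOnAxes (f + g) := Iff.rfl

/-- Integrate in `p` first and then in `x`; closedness in one index at a time suffices. The outer
homotopy vanishes at `x = 0`, the inner one at `p = 0`, and scaling `x` preserves `p = 0`. -/
theorem exists_mixed_primitive {G : Fin N → Fin N → Fn N} (hG : ∀ i j, ContDiff ℝ ∞ (G i j))
    (hl : ∀ i j k, pd (Sum.inl k) (G i j) = pd (Sum.inl i) (G k j))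
    (hr : ∀ i j k, pd (Sum.inr k) (G i j) = pd (Sum.inr j) (G i k)) :
    ∃ h : Fn N, ContDiff ℝ ∞ h ∧ (∀ i j, pd (Sum.inl i) (pd (Sum.inr j) h) = G i j) ∧
      VanishesOnAxes h := by
  have hp : ∀ i, ContDiff ℝ ∞ (primitive Sum.inr (G i)) := fun i =>
    contDiff_primitive Sum.inr_injective (hG i)
  refine ⟨primitive Sum.inl fun i => primitive Sum.inr (G i),
    contDiff_primitive Sum.inl_injective hp, fun i j => ?_, fun ξ hξ => ?_⟩
  · rw [pd_primitive_of_notMem Sum.inl_injective hp (by simp)]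
    simp only [pd_primitive Sum.inr_injective (hG _) fun a b => hr _ b a]
    exact pd_primitive Sum.inl_injective (fun k => hG k j) (fun a b => hl b j a) i
  · rcases hξ with hξ | hξ
    · exact primitive_eq_zero _ hξ
    · simp only [primitive, Finset.sum_apply, Pi.mul_apply, avg]
      refine Finset.sum_eq_zero fun k _ => ?_
      have : ∀ s l, scale Sum.inl s ξ (Sum.inr l) = 0 := fun s l => by
        rw [scale_apply_of_notMem _ _ (by simp), hξ]
      simp [this]

/-- Each `∂_p h` is independent of `x`, and at `x = 0` it differentiates a restriction that
vanishes. Hence `h` is independent of `p`, and it vanishes at `p = 0`. -/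
theorem eq_zero_of_mixed_eq_zero {h : Fn N} (hh : ContDiff ℝ ∞ h)
    (hm : ∀ i j, pd (Sum.inl i) (pd (Sum.inr j) h) = 0) (hz : VanishesOnAxes h) : h = 0 := by
  have h1 : ∀ j, pd (Sum.inr j) h = 0 := by
    intro j
    funext ξ
    rw [eq_scale_zero_of_pd_eq_zero (contDiff_pd hh _) (fun i => hm i j) ξ,
      ← pd_comp_scale_of_notMem hh (ι := Sum.inl) 0 (by simp)]
    have : (fun ζ => h (scale Sum.inl 0 ζ)) = 0 := by
      funext ζ
      refine hz _ (Or.inl fun i => ?_)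
      rw [scale_apply_of_mem Sum.inl_injective, zero_mul]
    rw [this, pd_zero]
  funext ξ
  rw [eq_scale_zero_of_pd_eq_zero hh h1 ξ]
  refine hz _ (Or.inr fun i => ?_)
  rw [scale_apply_of_mem Sum.inr_injective, zero_mul]

theorem existsUnique_mixedRelation (hF : ∀ μ ν, ContDiff ℝ ∞ (F μ ν))
    (hanti : ∀ μ ν, F ν μ = -F μ ν) (hI : Integrability F) {g : Fn N} (hg : ContDiff ℝ ∞ g) :
    ∃! f : Fn N, ContDiff ℝ ∞ f ∧ MixedRelation F f g ∧ Normalized f g := by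
  obtain ⟨h, hh, hm, hz⟩ := exists_mixed_primitive (contDiff_mixedPart hF)
    (pd_inl_mixedPart hF hanti hI) (pd_inr_mixedPart hF hanti hI)
  -- The sum `f + g` must be the normalized mixed primitive `h`.
  refine ⟨h - g, ⟨hh.sub hg, ?_, ?_⟩, ?_⟩
  · rw [mixedRelation_iff hF (smooth_sub hh hg) hg]
    simpa using hm
  · rw [normalized_iff]
    simpa using hz
  · rintro f ⟨hf, hfm, hfn⟩
    rw [mixedRelation_iff hF hf hg] at hfm
    have hs : ContDiff ℝ ∞ (f + g) := hf.add hg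
    have := eq_zero_of_mixed_eq_zero (h := f + g - h) (hs.sub hh) ?_ ?_
    · linear_combination (exp := 1) this
    · intro i j
      rw [pd_sub hs hh, pd_sub (contDiff_pd hs _) (contDiff_pd hh _), hfm, hm, sub_self]
    · intro ξ hξ
      rw [Pi.sub_apply, hz ξ hξ, normalized_iff.1 hfn ξ hξ, sub_self]

theorem contDiff_restrict {u : Fn N} (hu : ContDiff ℝ ∞ u) (ι : Fin N → Idx N) :
    ContDiff ℝ ∞ (fun ξ => u (scale ι 0 ξ)) := contDiff_comp_scale hu ι 0

theorem pd_restrict {u : Fn N} (hu : ContDiff ℝ ∞ u) {ι : Fin N → Idx N}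
    (hι : Function.Injective ι) (k : Fin N) : pd (ι k) (fun ξ => u (scale ι 0 ξ)) = 0 := by
  funext ξ
  rw [pd_comp_scale hu hι, zero_mul]
  rfl

/-- After subtracting `yPart` and `piPart`, the pure blocks say that the remainders are closed
one-forms in `p` and in `x`, hence gradients of some `f` and `g`. The freedom `f → f - c(x)`, `g → g
- d(p)` then achieves the normalization. -/
theorem DarbouxEq.exists_generates (hF : ∀ μ ν, ContDiff ℝ ∞ (F μ ν))
    (hanti : ∀ μ ν, F ν μ = -F μ ν) (hI : Integrability F) {e : Idx N → Fn N}
    (he : ∀ μ, ContDiff ℝ ∞ (e μ)) (h : DarbouxEq F e) : ∃ g, Generates F g e := by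
  have hd := darbouxEq_iff.1 h
  have hY := contDiff_yPart hF
  have hP := contDiff_piPart hF
  have hu : ∀ i, ContDiff ℝ ∞ (e (Sum.inl i) - yPart F i) := fun i => (he _).sub (hY i)
  have hv : ∀ i, ContDiff ℝ ∞ (e (Sum.inr i) - piPart F i) := fun i => (he _).sub (hP i)
  obtain ⟨f, hf, hfe⟩ : ∃ f : Fn N, ContDiff ℝ ∞ f ∧
      ∀ i, pd (Sum.inr i) f = e (Sum.inl i) - yPart F i := by
    refine ⟨primitive Sum.inr _, contDiff_primitive Sum.inr_injective hu,
      pd_primitive Sum.inr_injective hu fun i k => ?_⟩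
    rw [pd_sub (he _) (hY _), pd_sub (he _) (hY _)]
    have h1 := hd (Sum.inl i) (Sum.inl k)
    rw [← pd_yPart_sub hF hanti hI] at h1
    simp only [hamDeriv_inl] at h1
    linear_combination (exp := 1) h1
  obtain ⟨g, hg, hge⟩ : ∃ g : Fn N, ContDiff ℝ ∞ g ∧
      ∀ i, pd (Sum.inl i) g = e (Sum.inr i) - piPart F i := by
    refine ⟨primitive Sum.inl _, contDiff_primitive Sum.inl_injective hv,
      pd_primitive Sum.inl_injective hv fun i k => ?_⟩
    rw [pd_sub (he _) (hP _), pd_sub (he _) (hP _)]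
    have h1 := hd (Sum.inr i) (Sum.inr k)
    rw [← pd_piPart_sub hF hanti hI] at h1
    simp only [hamDeriv_inr] at h1
    linear_combination (exp := 1) -h1
  have hs : ContDiff ℝ ∞ (f + g) := hf.add hg
  -- With `h = f + g`, these are `c = h(x, 0)` and `d = h(0, p) - h(0, 0)`; the constant keeps the
  -- value at the origin from being subtracted twice.
  set c : Fn N := fun ξ => (f + g) (scale Sum.inr 0 ξ) with hc
  set d : Fn N := fun ξ => (f + g) (scale Sum.inl 0 ξ) - (f + g) 0 with hdd
  have hcs : ContDiff ℝ ∞ c := contDiff_restrict hs _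
  have hds : ContDiff ℝ ∞ d := (contDiff_restrict hs _).sub contDiff_const
  have hcp : ∀ i, pd (Sum.inr i) c = 0 := fun i => pd_restrict hs Sum.inr_injective i
  have hdp : ∀ i, pd (Sum.inl i) d = 0 := fun i => by
    have := pd_sub (contDiff_restrict hs Sum.inl) (contDiff_const (c := (f + g) 0)) (Sum.inl i)
    rw [pd_restrict hs Sum.inl_injective, pd_const, sub_zero] at this
    exact this
  have hsol : e = integralSol F (f - c) (g - d) := by
    funext μ
    rcases μ with i | i
    · rw [integralSol_inl hF, pd_sub hf hcs, hcp, hfe]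
      abel
    · rw [integralSol_inr hF, pd_sub hg hds, hdp, hge]
      abel
  refine ⟨g - d, hg.sub hds, f - c, hf.sub hcs, ?_, ?_, hsol⟩
  · rw [← darbouxEq_integralSol_iff hF hanti hI (smooth_sub hf hcs) (smooth_sub hg hds), ← hsol]
    exact h
  · have hz : ∀ ξ : Phase N, scale Sum.inl 0 (scale Sum.inr 0 ξ) = 0 := by
      intro ξ
      funext σ
      rcases σ with i | i
      · rw [scale_apply_of_mem Sum.inl_injective, zero_mul, Pi.zero_apply]
      · rw [scale_apply_of_notMem _ _ (by simp), scale_apply_of_mem Sum.inr_injective, zero_mul,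
          Pi.zero_apply]
    have hz' : ∀ ξ : Phase N, scale Sum.inr 0 (scale Sum.inl 0 ξ) = 0 := by
      intro ξ
      funext σ
      rcases σ with i | i
      · rw [scale_apply_of_notMem _ _ (by simp), scale_apply_of_mem Sum.inl_injective, zero_mul,
          Pi.zero_apply]
      · rw [scale_apply_of_mem Sum.inr_injective, zero_mul, Pi.zero_apply]
    intro ξ hξ
    rcases hξ with hξ | hξ
    · have h0 : scale Sum.inl 0 ξ = ξ := by
        funext σ
        rcases σ with i | i
        · rw [scale_apply_of_mem Sum.inl_injective, hξ, mul_zero]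
        · rw [scale_apply_of_notMem _ _ (by simp)]
      have h1 := hz' ξ
      rw [h0] at h1
      simp only [Pi.sub_apply, hc, hdd, h0, h1, Pi.add_apply]
      ring
    · have h0 : scale Sum.inr 0 ξ = ξ := by
        funext σ
        rcases σ with i | i
        · rw [scale_apply_of_notMem _ _ (by simp)]
        · rw [scale_apply_of_mem Sum.inr_injective, hξ, mul_zero]
      have h1 := hz ξ
      rw [h0] at h1
      simp only [Pi.sub_apply, hc, hdd, h0, h1, Pi.add_apply]
      ring

/-- For two generators of `e`, `g' - g` depends only on `p` and `f' - f` only on `x`. On `x = 0` the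
normalization makes them opposite, so `g' - g` is constant. -/
theorem Generates.iff_const (hF : ∀ μ ν, ContDiff ℝ ∞ (F μ ν)) {g : Fn N} {e : Idx N → Fn N}
    (h : Generates F g e) (g' : Fn N) :
    Generates F g' e ↔ ∃ c : ℝ, ∀ ξ, g' ξ = g ξ + c := by
  obtain ⟨hg, f, hf, hm, hn, he⟩ := h
  constructor
  · rintro ⟨hg', f', hf', hm', hn', he'⟩
    have hl : ∀ i, pd (Sum.inl i) (g' - g) = 0 := fun i => by
      have := congrFun (he.symm.trans he') (Sum.inr i)
      rw [integralSol_inr hF, integralSol_inr hF, add_right_inj] at this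
      rw [pd_sub hg' hg, this, sub_self]
    have hr : ∀ i, pd (Sum.inr i) (f' - f) = 0 := fun i => by
      have := congrFun (he.symm.trans he') (Sum.inl i)
      rw [integralSol_inl hF, integralSol_inl hF, add_right_inj] at this
      rw [pd_sub hf' hf, this, sub_self]
    refine ⟨g' 0 - g 0, fun ξ => ?_⟩
    have h0 : ∀ i, scale Sum.inl 0 ξ (Sum.inl i) = 0 := fun i => by
      rw [scale_apply_of_mem Sum.inl_injective, zero_mul]
    have hz' : scale Sum.inr 0 (scale Sum.inl 0 ξ) = 0 := by
      funext σ
      rcases σ with i | i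
      · rw [scale_apply_of_notMem _ _ (by simp), h0, Pi.zero_apply]
      · rw [scale_apply_of_mem Sum.inr_injective, zero_mul, Pi.zero_apply]
    have e1 := eq_scale_zero_of_pd_eq_zero (smooth_sub hg' hg) hl ξ
    have e2 := eq_scale_zero_of_pd_eq_zero (smooth_sub hf' hf) hr (scale Sum.inl 0 ξ)
    rw [hz'] at e2
    have n1 := hn _ (Or.inl h0)
    have n2 := hn' _ (Or.inl h0)
    have n3 := hn 0 (Or.inl fun _ => rfl)
    have n4 := hn' 0 (Or.inl fun _ => rfl)
    simp only [Pi.sub_apply] at e1 e2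
    linarith
  · rintro ⟨c, hc⟩
    have hcs : ContDiff ℝ ∞ (fun _ : Phase N => c) := contDiff_const
    have hg' : g' = g + fun _ => c := funext hc
    -- A constant added to `g` is subtracted from `f` to preserve the normalization; the gradients
    -- do not notice.
    have hsol : integralSol F (f - fun _ => c) g' = integralSol F f g := by
      funext μ
      rcases μ with i | i
      · rw [integralSol_inl hF, integralSol_inl hF, pd_sub hf hcs, pd_const, sub_zero]
      · rw [integralSol_inr hF, integralSol_inr hF, hg', pd_add hg hcs, pd_const, add_zero]
    refine ⟨hg' ▸ hg.add hcs, f - fun _ => c, hf.sub hcs, ?_, ?_, he.trans hsol.symm⟩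
    · intro i j ξ
      rw [hsol]
      exact hm i j ξ
    · intro ξ hξ
      have := hn ξ hξ
      rw [Pi.sub_apply, hc]
      linarith

theorem exists_darbouxEq (hF : ∀ μ ν, ContDiff ℝ ∞ (F μ ν))
    (hanti : ∀ μ ν, F ν μ = -F μ ν) (hI : Integrability F) :
    ∃ e : Idx N → Fn N, (∀ μ, ContDiff ℝ ∞ (e μ)) ∧ DarbouxEq F e := by
  have h0 : ContDiff ℝ ∞ (0 : Fn N) := contDiff_const
  obtain ⟨f, ⟨hf, hm, -⟩, -⟩ := existsUnique_mixedRelation hF hanti hI h0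
  exact ⟨_, contDiff_integralSol hF hf h0, (darbouxEq_integralSol_iff hF hanti hI hf h0).2 hm⟩

end FixedOrder

/-! ### Algebra of the cyclic double bracket over a commutative ring. -/

section JacobiAlgebra

variable {R I : Type*} [CommRing R] [Fintype I]

/-- Model of `{a,{b,c}}`: `a`, `b`, `c` stand for gradients, `B`, `C` for Hessians, `dΩ` for the
derivatives of `Ω`. Antisymmetry writes both Hessian terms with vectors of the form `v Ω`, which
fixes their opposite signs. -/
theorem nested_expand {Ω : I → I → R} (hΩ : ∀ i j, Ω j i = -Ω i j) (dΩ : I → I → I → R)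
    (a b c : I → R) (B C : I → I → R) :
    ∑ σ, ∑ ρ, a σ * Ω σ ρ *
        (∑ β, ∑ γ, (B ρ β * Ω β γ * c γ + b β * dΩ ρ β γ * c γ + b β * Ω β γ * C ρ γ))
      = (∑ σ, ∑ β, ∑ γ, a σ * b β * c γ * ∑ ρ, Ω σ ρ * dΩ ρ β γ)
        - (∑ ρ, ∑ β, (∑ σ, a σ * Ω σ ρ) * B ρ β * ∑ γ, c γ * Ω γ β)
        + ∑ ρ, ∑ γ, (∑ σ, a σ * Ω σ ρ) * C ρ γ * ∑ β, b β * Ω β γ := by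
  have h1 : ∑ ρ, ∑ β, (∑ σ, a σ * Ω σ ρ) * B ρ β * ∑ γ, c γ * Ω γ β
      = -∑ σ, ∑ ρ, a σ * Ω σ ρ * ∑ β, ∑ γ, B ρ β * Ω β γ * c γ := by
    rw [Finset.sum_comm (γ := I) (f := fun σ ρ => a σ * Ω σ ρ * _), ← Finset.sum_neg_distrib]
    refine Finset.sum_congr rfl fun ρ _ => ?_
    rw [← Finset.sum_mul, Finset.mul_sum, ← Finset.sum_neg_distrib]
    refine Finset.sum_congr rfl fun β _ => ?_
    have : ∑ γ, c γ * Ω γ β = -∑ γ, Ω β γ * c γ := by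
      rw [← Finset.sum_neg_distrib]
      exact Finset.sum_congr rfl fun γ _ => by rw [hΩ β γ]; ring
    simp only [this, mul_assoc]
    rw [← Finset.mul_sum]
    ring
  have h2 : ∑ ρ, ∑ γ, (∑ σ, a σ * Ω σ ρ) * C ρ γ * ∑ β, b β * Ω β γ
      = ∑ σ, ∑ ρ, a σ * Ω σ ρ * ∑ β, ∑ γ, b β * Ω β γ * C ρ γ := by
    rw [Finset.sum_comm (γ := I) (f := fun σ ρ => a σ * Ω σ ρ * _)]
    refine Finset.sum_congr rfl fun ρ _ => ?_
    rw [← Finset.sum_mul, Finset.sum_comm (γ := I) (f := fun β γ => b β * Ω β γ * C ρ γ),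
      Finset.mul_sum]
    refine Finset.sum_congr rfl fun γ _ => ?_
    rw [← Finset.sum_mul]
    ring
  have h3 : ∑ σ, ∑ β, ∑ γ, a σ * b β * c γ * ∑ ρ, Ω σ ρ * dΩ ρ β γ
      = ∑ σ, ∑ ρ, a σ * Ω σ ρ * ∑ β, ∑ γ, b β * dΩ ρ β γ * c γ := by
    refine Finset.sum_congr rfl fun σ _ => ?_
    simp only [Finset.mul_sum]
    rw [Finset.sum_comm (γ := I) (f := fun ρ β => ∑ γ, a σ * Ω σ ρ * _)]
    refine Finset.sum_congr rfl fun β _ => ?_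
    rw [Finset.sum_comm]
    exact Finset.sum_congr rfl fun ρ _ => Finset.sum_congr rfl fun γ _ => by ring
  rw [h1, h2, h3]
  simp only [Finset.sum_add_distrib, mul_add]
  ring

theorem quadratic_symm {A : I → I → R} (hA : ∀ i j, A j i = A i j) (u v : I → R) :
    ∑ i, ∑ j, u i * A i j * v j = ∑ i, ∑ j, v i * A i j * u j := by
  rw [Finset.sum_comm]
  exact Finset.sum_congr rfl fun j _ => Finset.sum_congr rfl fun i _ => by rw [hA j i]; ring

/-- In the cyclic sum each Hessian occurs twice with opposite signs and cancels by its symmetry. The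
terms with `dΩ` remain and assemble into the Jacobiator after relabelling. -/
theorem nested_cyclic_sum {Ω : I → I → R} (hΩ : ∀ i j, Ω j i = -Ω i j) (dΩ : I → I → I → R)
    (a b c : I → R) {A B C : I → I → R} (hA : ∀ i j, A j i = A i j)
    (hB : ∀ i j, B j i = B i j) (hC : ∀ i j, C j i = C i j) :
    (∑ σ, ∑ ρ, a σ * Ω σ ρ *
        (∑ β, ∑ γ, (B ρ β * Ω β γ * c γ + b β * dΩ ρ β γ * c γ + b β * Ω β γ * C ρ γ)))
    + (∑ σ, ∑ ρ, b σ * Ω σ ρ *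
        (∑ β, ∑ γ, (C ρ β * Ω β γ * a γ + c β * dΩ ρ β γ * a γ + c β * Ω β γ * A ρ γ)))
    + (∑ σ, ∑ ρ, c σ * Ω σ ρ *
        (∑ β, ∑ γ, (A ρ β * Ω β γ * b γ + a β * dΩ ρ β γ * b γ + a β * Ω β γ * B ρ γ)))
    = ∑ σ, ∑ β, ∑ γ, a σ * b β * c γ *
        ∑ ρ, (Ω σ ρ * dΩ ρ β γ + Ω γ ρ * dΩ ρ σ β + Ω β ρ * dΩ ρ γ σ) := by
  rw [nested_expand hΩ, nested_expand hΩ, nested_expand hΩ,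
    quadratic_symm hB (fun ρ => ∑ σ, a σ * Ω σ ρ), quadratic_symm hC (fun ρ => ∑ σ, a σ * Ω σ ρ),
    quadratic_symm hA (fun ρ => ∑ σ, b σ * Ω σ ρ)]
  have h1 : ∑ σ, ∑ β, ∑ γ, b σ * c β * a γ * ∑ ρ, Ω σ ρ * dΩ ρ β γ
      = ∑ σ, ∑ β, ∑ γ, a σ * b β * c γ * ∑ ρ, Ω β ρ * dΩ ρ γ σ := by
    rw [Finset.sum_comm' (t' := Finset.univ) (s' := fun _ => Finset.univ) (by simp)]
    conv_rhs => rw [Finset.sum_comm]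
    rw [Finset.sum_comm]
    refine Finset.sum_congr rfl fun σ _ => ?_
    rw [Finset.sum_comm]
    exact Finset.sum_congr rfl fun β _ => Finset.sum_congr rfl fun γ _ => by ring
  have h2 : ∑ σ, ∑ β, ∑ γ, c σ * a β * b γ * ∑ ρ, Ω σ ρ * dΩ ρ β γ
      = ∑ σ, ∑ β, ∑ γ, a σ * b β * c γ * ∑ ρ, Ω γ ρ * dΩ ρ σ β := by
    rw [Finset.sum_comm]
    refine Finset.sum_congr rfl fun σ _ => ?_
    rw [Finset.sum_comm]
    exact Finset.sum_congr rfl fun β _ => Finset.sum_congr rfl fun γ _ => by ring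
  rw [h1, h2]
  simp only [Finset.sum_add_distrib, mul_add]
  ring

end JacobiAlgebra

/-! ### Derivatives and Poisson brackets of formal series. -/

section FormalSeries

open PowerSeries

@[simp] theorem coeff_pdSer (n : ℕ) (σ : Idx N) (f : FSer N) :
    coeff n (pdSer σ f) = pd σ (coeff n f) := by
  rw [pdSer, coeff_mk]

theorem SmoothSer.add {f g : FSer N} (hf : SmoothSer f) (hg : SmoothSer g) :
    SmoothSer (f + g) := fun n => by
  rw [map_add]
  exact smooth_add (hf n) (hg n)

theorem SmoothSer.mul {f g : FSer N} (hf : SmoothSer f) (hg : SmoothSer g) :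
    SmoothSer (f * g) := fun n => by
  rw [coeff_mul]
  exact contDiff_finsetSum fun p _ => smooth_mul (hf _) (hg _)

theorem SmoothSer.sum {ι : Type*} {s : Finset ι} {f : ι → FSer N}
    (hf : ∀ i ∈ s, SmoothSer (f i)) : SmoothSer (∑ i ∈ s, f i) := fun n => by
  rw [map_sum]
  exact contDiff_finsetSum fun i hi => hf i hi n

theorem SmoothSer.pdSer {f : FSer N} (hf : SmoothSer f) (σ : Idx N) : SmoothSer (pdSer σ f) :=
  fun n => by
    rw [coeff_pdSer]
    exact contDiff_pd (hf n) σ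

theorem smoothSer_C {f : Fn N} (hf : ContDiff ℝ ∞ f) : SmoothSer (C f) := fun n => by
  rw [coeff_C]
  split_ifs
  · exact hf
  · exact contDiff_const

theorem pdSer_mul {f g : FSer N} (hf : SmoothSer f) (hg : SmoothSer g) (σ : Idx N) :
    pdSer σ (f * g) = pdSer σ f * g + f * pdSer σ g := by
  ext1 n
  simp only [coeff_pdSer, map_add, coeff_mul]
  rw [pd_sum fun p _ => smooth_mul (hf _) (hg _), ← Finset.sum_add_distrib]
  exact Finset.sum_congr rfl fun p _ => pd_mul (hf _) (hg _) σ

theorem pdSer_sum {ι : Type*} {s : Finset ι} {f : ι → FSer N}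
    (hf : ∀ i ∈ s, SmoothSer (f i)) (σ : Idx N) :
    pdSer σ (∑ i ∈ s, f i) = ∑ i ∈ s, pdSer σ (f i) := by
  ext1 n
  simp only [coeff_pdSer, map_sum]
  rw [pd_sum fun i hi => hf i hi n]

theorem pdSer_comm {f : FSer N} (hf : SmoothSer f) (σ ρ : Idx N) :
    pdSer σ (pdSer ρ f) = pdSer ρ (pdSer σ f) := by
  ext1 n
  simp only [coeff_pdSer, pd_comm (hf n) σ ρ]

theorem pdSer_C (σ : Idx N) (f : Fn N) : pdSer σ (C f) = C (pd σ f) := by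
  ext1 n
  rw [coeff_pdSer, coeff_C, coeff_C]
  split_ifs <;> simp

variable {Ω : Matrix (Idx N) (Idx N) (FSer N)}

theorem SmoothSer.bracket (hΩ : IsDeformation Ω) {f g : FSer N} (hf : SmoothSer f)
    (hg : SmoothSer g) : SmoothSer (bracket Ω f g) :=
  SmoothSer.sum fun σ _ => SmoothSer.sum fun ρ _ =>
    ((hf.pdSer σ).mul (hΩ.smooth σ ρ)).mul (hg.pdSer ρ)

theorem pdSer_bracket (hΩ : IsDeformation Ω) {f g : FSer N} (hf : SmoothSer f)
    (hg : SmoothSer g) (τ : Idx N) :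
    pdSer τ (bracket Ω f g) = ∑ σ, ∑ ρ, (pdSer τ (pdSer σ f) * Ω σ ρ * pdSer ρ g
      + pdSer σ f * pdSer τ (Ω σ ρ) * pdSer ρ g + pdSer σ f * Ω σ ρ * pdSer τ (pdSer ρ g)) := by
  have h : ∀ σ ρ, SmoothSer (pdSer σ f * Ω σ ρ) := fun σ ρ => (hf.pdSer σ).mul (hΩ.smooth σ ρ)
  rw [FormalDarboux.bracket, pdSer_sum fun σ _ => SmoothSer.sum fun ρ _ =>
    (h σ ρ).mul (hg.pdSer ρ)]
  refine Finset.sum_congr rfl fun σ _ => ?_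
  rw [pdSer_sum fun ρ _ => (h σ ρ).mul (hg.pdSer ρ)]
  refine Finset.sum_congr rfl fun ρ _ => ?_
  rw [pdSer_mul (h σ ρ) (hg.pdSer ρ), pdSer_mul (hf.pdSer σ) (hΩ.smooth σ ρ)]
  ring

/-- The Jacobi identity is not assumed, so the formula can be read off order by order while only the
lower orders of the Jacobiator are known to vanish. -/
theorem bracket_cyclic_sum (hΩ : IsDeformation Ω) {a b c : FSer N} (ha : SmoothSer a)
    (hb : SmoothSer b) (hc : SmoothSer c) :
    bracket Ω a (bracket Ω b c) + bracket Ω b (bracket Ω c a) + bracket Ω c (bracket Ω a b)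
      = ∑ σ, ∑ β, ∑ γ, pdSer σ a * pdSer β b * pdSer γ c * jacobiator Ω σ β γ := by
  have key := nested_cyclic_sum (Ω := fun σ ρ => Ω σ ρ) (fun i j => hΩ.antisymm i j)
    (fun ρ β γ => pdSer ρ (Ω β γ)) (fun σ => pdSer σ a) (fun σ => pdSer σ b) (fun σ => pdSer σ c)
    (A := fun ρ σ => pdSer ρ (pdSer σ a)) (B := fun ρ σ => pdSer ρ (pdSer σ b))
    (C := fun ρ σ => pdSer ρ (pdSer σ c)) (fun i j => pdSer_comm ha j i)
    (fun i j => pdSer_comm hb j i) (fun i j => pdSer_comm hc j i)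
  simp only [← pdSer_bracket hΩ hb hc, ← pdSer_bracket hΩ hc ha, ← pdSer_bracket hΩ ha hb] at key
  exact key

theorem coeff_mul_of_lower_eq_zero {R : Type*} [CommSemiring R] {n : ℕ} (f : PowerSeries R)
    {g : PowerSeries R} (hg : ∀ r < n, coeff r g = 0) :
    coeff n (f * g) = coeff 0 f * coeff n g := by
  rw [coeff_mul, Finset.sum_eq_single (0, n)]
  · rintro ⟨i, j⟩ hij hne
    rw [Finset.HasAntidiagonal.mem_antidiagonal] at hij
    have : j < n := by
      by_contra hj
      exact hne (by ext <;> simp <;> omega)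
    rw [hg j this, mul_zero]
  · intro h
    simp at h

end FormalSeries

/-! ### Nested sums as sums over compositions of `n`. -/

section Reindexing

variable {M : Type*} [AddCommMonoid M]

/-- Ordered decompositions of `n` into three positive parts. -/
def triples (n : ℕ) : Finset (ℕ × ℕ × ℕ) :=
  (Finset.range (n + 1) ×ˢ Finset.range (n + 1) ×ˢ Finset.range (n + 1)).filter
    fun q => 1 ≤ q.1 ∧ 1 ≤ q.2.1 ∧ 1 ≤ q.2.2 ∧ q.1 + q.2.1 + q.2.2 = n

theorem mem_triples {n a b c : ℕ} :
    (a, b, c) ∈ triples n ↔ 1 ≤ a ∧ 1 ≤ b ∧ 1 ≤ c ∧ a + b + c = n := by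
  simp only [triples, Finset.mem_filter, Finset.mem_product, Finset.mem_range]
  omega

/-- Ordered decompositions of `n` into four positive parts. -/
def quadruples (n : ℕ) : Finset (ℕ × ℕ × ℕ × ℕ) :=
  (Finset.range (n + 1) ×ˢ Finset.range (n + 1) ×ˢ Finset.range (n + 1) ×ˢ
    Finset.range (n + 1)).filter
    fun q => 1 ≤ q.1 ∧ 1 ≤ q.2.1 ∧ 1 ≤ q.2.2.1 ∧ 1 ≤ q.2.2.2 ∧ q.1 + q.2.1 + q.2.2.1 + q.2.2.2 = n

theorem mem_quadruples {n a b c d : ℕ} :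
    (a, b, c, d) ∈ quadruples n ↔
      1 ≤ a ∧ 1 ≤ b ∧ 1 ≤ c ∧ 1 ≤ d ∧ a + b + c + d = n := by
  simp only [quadruples, Finset.mem_filter, Finset.mem_product, Finset.mem_range]
  omega

theorem sum_Icc_eq_sum_triples (n : ℕ) (g : ℕ → ℕ → ℕ → M) :
    ∑ m ∈ Finset.Icc 1 (n - 2), ∑ k ∈ Finset.Icc 1 (n - m - 1), g m (n - m - k) k
      = ∑ q ∈ triples n, g q.1 q.2.1 q.2.2 := by
  rw [Finset.sum_sigma']
  refine Finset.sum_nbij' (fun x => (x.1, n - x.1 - x.2, x.2)) (fun q => ⟨q.1, q.2.2⟩) ?_ ?_ ?_ ?_ ?_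
  · rintro ⟨m, k⟩ h
    simp only [Finset.mem_sigma, Finset.mem_Icc] at h
    simp only [mem_triples]
    omega
  · rintro ⟨a, b, c⟩ h
    rw [mem_triples] at h
    simp only [Finset.mem_sigma, Finset.mem_Icc]
    omega
  · rintro ⟨m, k⟩ _
    rfl
  · rintro ⟨a, b, c⟩ h
    rw [mem_triples] at h
    simp only [Prod.mk.injEq, true_and, and_true]
    omega
  · rintro ⟨m, k⟩ _
    rfl

theorem sum_Icc_eq_sum_quadruples (n : ℕ) (g : ℕ → ℕ → ℕ → ℕ → M) :
    ∑ m ∈ Finset.Icc 1 (n - 3), ∑ k ∈ Finset.Icc 1 (n - m - 2),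
      ∑ l ∈ Finset.Icc 1 (n - m - k - 1), g m l k (n - m - k - l)
      = ∑ q ∈ quadruples n, g q.1 q.2.1 q.2.2.1 q.2.2.2 := by
  simp only [Finset.sum_sigma']
  refine Finset.sum_nbij' (fun x => (x.1, x.2.2, x.2.1, n - x.1 - x.2.1 - x.2.2))
    (fun q => ⟨q.1, q.2.2.1, q.2.1⟩) ?_ ?_ ?_ ?_ ?_
  · rintro ⟨m, k, l⟩ h
    simp only [Finset.mem_sigma, Finset.mem_Icc] at h
    simp only [mem_quadruples]
    omega
  · rintro ⟨a, b, c, d⟩ h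
    rw [mem_quadruples] at h
    simp only [Finset.mem_sigma, Finset.mem_Icc]
    omega
  · rintro ⟨m, k, l⟩ _
    rfl
  · rintro ⟨a, b, c, d⟩ h
    rw [mem_quadruples] at h
    simp only [Prod.mk.injEq, true_and]
    omega
  · rintro ⟨m, k, l⟩ _
    rfl

theorem sum_triples_rotate (n : ℕ) (g : ℕ → ℕ → ℕ → M) :
    ∑ q ∈ triples n, g q.1 q.2.1 q.2.2 = ∑ q ∈ triples n, g q.2.1 q.2.2 q.1 := by
  refine Finset.sum_nbij' (fun q => (q.2.2, q.1, q.2.1)) (fun q => (q.2.1, q.2.2, q.1))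
    ?_ ?_ ?_ ?_ ?_
  · rintro ⟨a, b, c⟩ h
    simp only [mem_triples] at h ⊢
    omega
  · rintro ⟨a, b, c⟩ h
    simp only [mem_triples] at h ⊢
    omega
  all_goals exact fun _ _ => rfl

theorem sum_quadruples_rotate (n : ℕ) (g : ℕ → ℕ → ℕ → ℕ → M) :
    ∑ q ∈ quadruples n, g q.1 q.2.1 q.2.2.1 q.2.2.2
      = ∑ q ∈ quadruples n, g q.2.1 q.2.2.1 q.1 q.2.2.2 := by
  refine Finset.sum_nbij' (fun q => (q.2.2.1, q.1, q.2.1, q.2.2.2))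
    (fun q => (q.2.1, q.2.2.1, q.1, q.2.2.2)) ?_ ?_ ?_ ?_ ?_
  · rintro ⟨a, b, c, d⟩ h
    simp only [mem_quadruples] at h ⊢
    omega
  · rintro ⟨a, b, c, d⟩ h
    simp only [mem_quadruples] at h ⊢
    omega
  all_goals exact fun _ _ => rfl

/-- In the second family of terms of the first auxiliary identity the order of `Ω` is the middle
summation index, not the remainder; this permutation moves it to the last slot. -/
theorem sum_quadruples_rotate_tail (n : ℕ) (g : ℕ → ℕ → ℕ → ℕ → M) :
    ∑ q ∈ quadruples n, g q.1 q.2.1 q.2.2.1 q.2.2.2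
      = ∑ q ∈ quadruples n, g q.1 q.2.2.1 q.2.2.2 q.2.1 := by
  refine Finset.sum_nbij' (fun q => (q.1, q.2.2.2, q.2.1, q.2.2.1))
    (fun q => (q.1, q.2.2.1, q.2.2.2, q.2.1)) ?_ ?_ ?_ ?_ ?_
  · rintro ⟨a, b, c, d⟩ h
    simp only [mem_quadruples] at h ⊢
    omega
  · rintro ⟨a, b, c, d⟩ h
    simp only [mem_quadruples] at h ⊢
    omega
  all_goals exact fun _ _ => rfl

theorem sum_antidiagonal_split {t : ℕ} (ht : 1 ≤ t) (g : ℕ → ℕ → M) :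
    ∑ q ∈ Finset.HasAntidiagonal.antidiagonal t, g q.1 q.2
      = g 0 t + g t 0 + ∑ p ∈ Finset.Icc 1 (t - 1), g p (t - p) := by
  rw [Finset.Nat.sum_antidiagonal_eq_sum_range_succ g]
  have : Finset.range t.succ = insert 0 (insert t (Finset.Icc 1 (t - 1))) := by
    ext x
    simp only [Finset.mem_range, Finset.mem_insert, Finset.mem_Icc]
    omega
  rw [this, Finset.sum_insert, Finset.sum_insert, Nat.sub_zero, Nat.sub_self, add_assoc]
  · simp only [Finset.mem_Icc]
    omega
  · simp only [Finset.mem_insert, Finset.mem_Icc]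
    omega

theorem sum_Icc_extend {a b : ℕ} (hab : a ≤ b) (g : ℕ → M)
    (hg : ∀ m, a < m → m ≤ b → g m = 0) :
    ∑ m ∈ Finset.Icc 1 a, g m = ∑ m ∈ Finset.Icc 1 b, g m := by
  refine Finset.sum_subset (Finset.Icc_subset_Icc_right hab) fun m hm hm' => ?_
  simp only [Finset.mem_Icc] at hm hm'
  exact hg m (by omega) hm.2

theorem sum_Icc_four_eq_sum_quadruples (n : ℕ) (T : ℕ → ℕ → ℕ → ℕ → ℕ → M) :
    ∑ m ∈ Finset.Icc 1 (n - 4), ∑ k ∈ Finset.Icc 1 (n - m - 3),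
      ∑ l ∈ Finset.Icc 1 (n - m - k - 2), ∑ p ∈ Finset.Icc 1 (n - m - k - l - 1),
        T p (n - m - k - l - p) m l k
      = ∑ q ∈ quadruples n, ∑ p ∈ Finset.Icc 1 (q.2.2.2 - 1),
          T p (q.2.2.2 - p) q.1 q.2.1 q.2.2.1 := by
  rw [← sum_Icc_eq_sum_quadruples n fun m l k t => ∑ p ∈ Finset.Icc 1 (t - 1), T p (t - p) m l k]
  have h0 : ∀ {c : ℕ} (hc : c = 0) (g : ℕ → M), ∑ p ∈ Finset.Icc 1 c, g p = 0 := by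
    rintro c rfl g
    simp
  -- Each upper bound is raised to the one for compositions into four parts; the added terms vanish
  -- because their inner range is empty.
  rw [sum_Icc_extend (b := n - 3) (by omega)]
  · refine Finset.sum_congr rfl fun m _ => ?_
    rw [sum_Icc_extend (b := n - m - 2) (by omega)]
    · refine Finset.sum_congr rfl fun k _ => ?_
      exact sum_Icc_extend (by omega) _ fun l hl hl' => h0 (by omega) _
    · exact fun k hk hk' => h0 (by omega) _
  · exact fun m hm hm' => h0 (by omega) _

/-- The three families are the two endpoints and the interior of one convolution over the orders of
the two factors `Ω`, at fixed total order. -/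
theorem sum_nested_eq_sum_quadruples (n : ℕ) (T : ℕ → ℕ → ℕ → ℕ → ℕ → M) :
    (∑ m ∈ Finset.Icc 1 (n - 3), ∑ k ∈ Finset.Icc 1 (n - m - 2),
      ∑ l ∈ Finset.Icc 1 (n - m - k - 1),
        (T 0 (n - m - k - l) m l k + T k 0 m (n - m - k - l) l))
    + ∑ m ∈ Finset.Icc 1 (n - 4), ∑ k ∈ Finset.Icc 1 (n - m - 3),
      ∑ l ∈ Finset.Icc 1 (n - m - k - 2), ∑ p ∈ Finset.Icc 1 (n - m - k - l - 1),
        T p (n - m - k - l - p) m l k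
    = ∑ q ∈ quadruples n, ∑ s ∈ Finset.HasAntidiagonal.antidiagonal q.2.2.2,
        T s.1 s.2 q.1 q.2.1 q.2.2.1 := by
  rw [sum_Icc_four_eq_sum_quadruples]
  simp only [Finset.sum_add_distrib]
  rw [sum_Icc_eq_sum_quadruples n fun m l k t => T 0 t m l k,
    sum_Icc_eq_sum_quadruples n fun m l k t => T k 0 m t l,
    sum_quadruples_rotate_tail n fun m l k t => T k 0 m t l,
    ← Finset.sum_add_distrib, ← Finset.sum_add_distrib]
  refine Finset.sum_congr rfl ?_
  rintro ⟨a, b, c, d⟩ h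
  rw [mem_quadruples] at h
  exact (sum_antidiagonal_split h.2.2.2.1 fun p r => T p r a b c).symm

end Reindexing

/-! ### The two auxiliary identities. -/

section AuxiliaryIdentities

open PowerSeries

variable {Ω : Matrix (Idx N) (Idx N) (FSer N)}

theorem coeff_bracket_C_C (b c : Fn N) (r : ℕ) :
    coeff r (bracket Ω (C b) (C c))
      = fun ζ => ∑ β, ∑ γ, pd β b ζ * coeffMat Ω r β γ ζ * pd γ c ζ := by
  funext ζ
  simp only [bracket, pdSer_C, map_sum, coeff_mul_C, coeff_C_mul, Finset.sum_apply, Pi.mul_apply,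
    coeffMat]

/-- For `θ`-independent functions only the two factors `Ω` carry powers of `θ`. The sign arises
because `nested` contracts its outer matrix with transposed indices. -/
theorem coeff_nested_bracket (hΩ : IsDeformation Ω) (a b c : Fn N) (t : ℕ) (ξ : Phase N) :
    coeff t (bracket Ω (C a) (bracket Ω (C b) (C c))) ξ
      = -∑ s ∈ Finset.HasAntidiagonal.antidiagonal t, nested (coeffMat Ω s.1) (coeffMat Ω s.2) a b c ξ := by
  have h : ∀ σ ρ, coeff t (pdSer σ (C a) * Ω σ ρ * pdSer ρ (bracket Ω (C b) (C c))) ξ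
      = ∑ s ∈ Finset.HasAntidiagonal.antidiagonal t, -(pd σ a ξ * coeffMat Ω s.1 ρ σ ξ
        * pd ρ (fun ζ => ∑ β, ∑ γ, pd β b ζ * coeffMat Ω s.2 β γ ζ * pd γ c ζ) ξ) := by
    intro σ ρ
    rw [pdSer_C, mul_assoc, coeff_C_mul, coeff_mul, Finset.mul_sum, Finset.sum_apply]
    refine Finset.sum_congr rfl fun s _ => ?_
    rw [coeff_pdSer, coeff_bracket_C_C, coeffMat, hΩ.antisymm σ ρ, map_neg]
    simp only [Pi.mul_apply, Pi.neg_apply]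
    ring
  rw [bracket]
  simp only [map_sum, Finset.sum_apply, h, nested, Finset.sum_neg_distrib, neg_inj]
  conv_rhs => rw [Finset.sum_comm]
  refine Finset.sum_congr rfl fun σ _ => ?_
  rw [Finset.sum_comm]

/-- Order `t` of `bracket_cyclic_sum` for three constant series. -/
theorem nested_antidiagonal_cyclic_sum (hΩ : IsDeformation Ω) {a b c : Fn N}
    (ha : ContDiff ℝ ∞ a) (hb : ContDiff ℝ ∞ b) (hc : ContDiff ℝ ∞ c) {t : ℕ}
    (hJ : ∀ r ≤ t, ∀ μ ν α, coeff r (jacobiator Ω μ ν α) = 0) (ξ : Phase N) :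
    (∑ s ∈ Finset.HasAntidiagonal.antidiagonal t, nested (coeffMat Ω s.1) (coeffMat Ω s.2) a b c ξ)
    + (∑ s ∈ Finset.HasAntidiagonal.antidiagonal t, nested (coeffMat Ω s.1) (coeffMat Ω s.2) b c a ξ)
    + ∑ s ∈ Finset.HasAntidiagonal.antidiagonal t, nested (coeffMat Ω s.1) (coeffMat Ω s.2) c a b ξ = 0 := by
  have key := congrFun (congrArg (coeff t) (bracket_cyclic_sum hΩ (smoothSer_C ha)
    (smoothSer_C hb) (smoothSer_C hc))) ξ
  simp only [map_add, Pi.add_apply, coeff_nested_bracket hΩ] at key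
  have h0 : coeff t (∑ σ, ∑ β, ∑ γ, pdSer σ (C a) * pdSer β (C b) * pdSer γ (C c)
      * jacobiator Ω σ β γ) = 0 := by
    simp only [map_sum]
    refine Finset.sum_eq_zero fun σ _ => Finset.sum_eq_zero fun β _ =>
      Finset.sum_eq_zero fun γ _ => ?_
    rw [coeff_mul_of_lower_eq_zero _ fun r hr => hJ r hr.le σ β γ, hJ t le_rfl, mul_zero]
  rw [h0, Pi.zero_apply] at key
  linarith

theorem coeffMat_zero (hΩ : IsDeformation Ω) :
    coeffMat Ω 0 = fun ρ σ _ => Omega0 N ρ σ := by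
  funext ρ σ
  exact hΩ.zeroth ρ σ

theorem sumM_eq (hΩ : IsDeformation Ω) (η : Idx N → FSer N) (n : ℕ) (μ ν α : Idx N)
    (ξ : Phase N) :
    sumM Ω η n μ ν α ξ = ∑ q ∈ quadruples n, ∑ s ∈ Finset.HasAntidiagonal.antidiagonal q.2.2.2,
      nested (coeffMat Ω s.1) (coeffMat Ω s.2) (coeff q.1 (η μ)) (coeff q.2.1 (η ν))
        (coeff q.2.2.1 (η α)) ξ := by
  rw [← sum_nested_eq_sum_quadruples n fun p r m l k => nested (coeffMat Ω p) (coeffMat Ω r)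
    (coeff m (η μ)) (coeff l (η ν)) (coeff k (η α)) ξ, coeffMat_zero hΩ]
  rfl

theorem sumN_eq (η : Idx N → FSer N) (n : ℕ) (μ ν α : Idx N) (ξ : Phase N) :
    sumN η n μ ν α ξ = ∑ q ∈ triples n,
      nested (fun ρ σ _ => Omega0 N ρ σ) (fun β γ _ => Omega0 N β γ)
        (coeff q.1 (η μ)) (coeff q.2.1 (η ν)) (coeff q.2.2 (η α)) ξ :=
  sum_Icc_eq_sum_triples n fun m l k =>
    nested (fun ρ σ _ => Omega0 N ρ σ) (fun β γ _ => Omega0 N β γ)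
      (coeff m (η μ)) (coeff l (η ν)) (coeff k (η α)) ξ

theorem sumM_cyclic_sum (hΩ : IsDeformation Ω) {η : Idx N → FSer N}
    (hη : ∀ μ, SmoothSer (η μ)) {n : ℕ}
    (hJ : ∀ r < n, ∀ μ ν α, coeff r (jacobiator Ω μ ν α) = 0) (α μ ν : Idx N) :
    sumM Ω η n μ ν α + sumM Ω η n ν α μ + sumM Ω η n α μ ν = 0 := by
  funext ξ
  simp only [Pi.add_apply, sumM_eq hΩ, Pi.zero_apply]
  -- Rotations attach the same orders to the same components in all three cyclic sums: `m` to `μ`,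
  -- `l` to `ν`, `k` to `α`. The third sum needs two of them.
  rw [sum_quadruples_rotate n fun m l k t => ∑ s ∈ Finset.HasAntidiagonal.antidiagonal t,
      nested (coeffMat Ω s.1) (coeffMat Ω s.2) (coeff m (η ν)) (coeff l (η α)) (coeff k (η μ)) ξ,
    sum_quadruples_rotate n fun m l k t => ∑ s ∈ Finset.HasAntidiagonal.antidiagonal t,
      nested (coeffMat Ω s.1) (coeffMat Ω s.2) (coeff m (η α)) (coeff l (η μ)) (coeff k (η ν)) ξ,
    sum_quadruples_rotate n fun l k m t => ∑ s ∈ Finset.HasAntidiagonal.antidiagonal t,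
      nested (coeffMat Ω s.1) (coeffMat Ω s.2) (coeff k (η α)) (coeff m (η μ)) (coeff l (η ν)) ξ,
    ← Finset.sum_add_distrib, ← Finset.sum_add_distrib]
  refine Finset.sum_eq_zero ?_
  rintro ⟨m, l, k, t⟩ h
  rw [mem_quadruples] at h
  -- Since `m`, `l`, `k` are positive, `t < n`, so only orders of the Jacobiator below `n` enter.
  exact nested_antidiagonal_cyclic_sum hΩ (hη μ m) (hη ν l) (hη α k)
    (fun r (hr : r ≤ t) => hJ r (by omega)) ξ

theorem sumN_cyclic_sum (hΩ : IsDeformation Ω) {η : Idx N → FSer N}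
    (hη : ∀ μ, SmoothSer (η μ)) (n : ℕ)
    (hJ : ∀ μ ν α, coeff 0 (jacobiator Ω μ ν α) = 0) (α μ ν : Idx N) :
    sumN η n μ ν α + sumN η n ν α μ + sumN η n α μ ν = 0 := by
  funext ξ
  simp only [Pi.add_apply, sumN_eq, Pi.zero_apply, ← coeffMat_zero hΩ]
  rw [sum_triples_rotate n fun m l k =>
      nested (coeffMat Ω 0) (coeffMat Ω 0) (coeff m (η ν)) (coeff l (η α)) (coeff k (η μ)) ξ,
    sum_triples_rotate n fun m l k =>
      nested (coeffMat Ω 0) (coeffMat Ω 0) (coeff m (η α)) (coeff l (η μ)) (coeff k (η ν)) ξ,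
    sum_triples_rotate n fun l k m =>
      nested (coeffMat Ω 0) (coeffMat Ω 0) (coeff k (η α)) (coeff m (η μ)) (coeff l (η ν)) ξ,
    ← Finset.sum_add_distrib, ← Finset.sum_add_distrib]
  refine Finset.sum_eq_zero ?_
  rintro ⟨m, l, k⟩ h
  have := nested_antidiagonal_cyclic_sum hΩ (hη μ m) (hη ν l) (hη α k) (t := 0)
    (fun r hr => by rw [Nat.le_zero.1 hr]; exact hJ) ξ
  simpa only [Finset.Nat.antidiagonal_zero, Finset.sum_singleton] using this

end AuxiliaryIdentities

/-! ### Generating series of the inhomogeneities, and their relation to the Jacobiator. -/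

noncomputable section InhomogeneitySeries

open PowerSeries

/-- The series without its constant coefficient. -/
def tail (f : FSer N) : FSer N := f - C (coeff 0 f)

@[simp] theorem coeff_zero_tail (f : FSer N) : coeff 0 (tail f) = 0 := by
  rw [tail, map_sub, coeff_C, if_pos rfl, sub_self]

theorem coeff_tail {n : ℕ} (hn : n ≠ 0) (f : FSer N) : coeff n (tail f) = coeff n f := by
  rw [tail, map_sub, coeff_C, if_neg hn, sub_zero]

theorem SmoothSer.tail {f : FSer N} (hf : SmoothSer f) : SmoothSer (tail f) := fun n => by
  rcases eq_or_ne n 0 with rfl | hn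
  · rw [coeff_zero_tail]
    exact contDiff_const
  · rw [coeff_tail hn]
    exact hf n

/-- The generating series of the inhomogeneities. -/
def inhomSer (Ω : Matrix (Idx N) (Idx N) (FSer N)) (η : Idx N → FSer N) (μ ν : Idx N) : FSer N :=
  tail (Ω μ ν)
  + ((∑ σ, ∑ ρ, pdSer σ (tail (η μ)) * C (fun _ => Omega0 N σ ρ) * pdSer ρ (tail (η ν)))
    + (∑ σ, pdSer σ (tail (η μ)) * tail (Ω σ ν))
    + ∑ σ, tail (Ω μ σ) * pdSer σ (tail (η ν)))
  + ∑ σ, ∑ ρ, pdSer σ (tail (η μ)) * tail (Ω σ ρ) * pdSer ρ (tail (η ν))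

/-- The left-hand sides of the Darboux equations of all orders, as one series. -/
def darbouxSer (Ω : Matrix (Idx N) (Idx N) (FSer N)) (η : Idx N → FSer N) (μ ν : Idx N) :
    FSer N :=
  (∑ σ, pdSer σ (tail (η μ)) * C (fun _ => Omega0 N σ ν))
  + (∑ σ, C (fun _ => Omega0 N μ σ) * pdSer σ (tail (η ν))) + inhomSer Ω η μ ν

/-- With `∂η = δ + d` and `Ω = Ω⁰ + w` the bracket has eight terms: `Ω⁰`, the two terms linear in
the unknown, and the five that make up the inhomogeneity. -/
theorem sum_delta_expand {R I : Type*} [CommRing R] [Fintype I] [DecidableEq I]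
    (o w : I → I → R) (d d' : I → R) (μ ν : I) :
    ∑ σ, ∑ ρ, ((if σ = μ then 1 else 0) + d σ) * (o σ ρ + w σ ρ)
        * ((if ρ = ν then 1 else 0) + d' ρ)
      = o μ ν + ((∑ σ, d σ * o σ ν) + (∑ σ, o μ σ * d' σ)
        + (w μ ν + ((∑ σ, ∑ ρ, d σ * o σ ρ * d' ρ) + (∑ σ, d σ * w σ ν) + ∑ σ, w μ σ * d' σ)
        + ∑ σ, ∑ ρ, d σ * w σ ρ * d' ρ)) := by
  simp only [add_mul, mul_add, ite_mul, mul_ite, zero_mul, mul_zero, one_mul, mul_one,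
    Finset.sum_add_distrib, Finset.sum_ite_eq', Finset.mem_univ, if_true]
  simp only [Finset.sum_ite_irrel, Finset.sum_const_zero, Finset.sum_ite_eq', Finset.mem_univ,
    if_true]
  ring

variable {Ω : Matrix (Idx N) (Idx N) (FSer N)} {η : Idx N → FSer N}

theorem pdSer_eq_delta_add (hη : IsFormalChange η) (σ μ : Idx N) :
    pdSer σ (η μ) = (if σ = μ then 1 else 0) + pdSer σ (tail (η μ)) := by
  ext n : 1
  rw [map_add, coeff_pdSer, coeff_pdSer]
  rcases eq_or_ne n 0 with rfl | hn
  · rw [coeff_zero_tail, pd_zero, add_zero, hη.zeroth]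
    funext ξ
    rw [pd_coord]
    split_ifs <;> simp
  · rw [coeff_tail hn]
    split_ifs <;> simp [coeff_one, hn]

theorem eq_C_add_tail (hΩ : IsDeformation Ω) (σ ρ : Idx N) :
    Ω σ ρ = C (fun _ => Omega0 N σ ρ) + tail (Ω σ ρ) := by
  rw [tail, hΩ.zeroth, add_sub_cancel]

theorem bracket_eq (hΩ : IsDeformation Ω) (hη : IsFormalChange η) (μ ν : Idx N) :
    bracket Ω (η μ) (η ν) = C (fun _ => Omega0 N μ ν) + darbouxSer Ω η μ ν := by
  rw [darbouxSer, inhomSer, ← sum_delta_expand (fun σ ρ => C (fun _ => Omega0 N σ ρ))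
    (fun σ ρ => tail (Ω σ ρ)) (fun σ => pdSer σ (tail (η μ))) (fun σ => pdSer σ (tail (η ν))) μ ν]
  simp only [← pdSer_eq_delta_add hη, ← eq_C_add_tail hΩ]
  rfl

theorem sum_antidiagonal_eq_sum_Icc {M : Type*} [AddCommMonoid M] (n : ℕ) (g : ℕ → ℕ → M)
    (hl : ∀ b, g 0 b = 0) (hr : ∀ a, g a 0 = 0) :
    ∑ q ∈ Finset.HasAntidiagonal.antidiagonal n, g q.1 q.2
      = ∑ m ∈ Finset.Icc 1 (n - 1), g (n - m) m := by
  rcases Nat.eq_zero_or_pos n with rfl | hn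
  · simp [hl]
  · rw [← Finset.Nat.sum_antidiagonal_swap]
    refine (sum_antidiagonal_split hn fun b a => g a b).trans ?_
    simp [hl, hr]

theorem coeff_mul_eq_sum_Icc {R : Type*} [CommRing R] {f g : PowerSeries R} (hf : coeff 0 f = 0)
    (hg : coeff 0 g = 0) (n : ℕ) :
    coeff n (f * g) = ∑ m ∈ Finset.Icc 1 (n - 1), coeff (n - m) f * coeff m g := by
  rw [coeff_mul, sum_antidiagonal_eq_sum_Icc n fun a b => coeff a f * coeff b g]
  · simp [hf]
  · simp [hg]

theorem coeff_zero_mul_of_left {R : Type*} [CommRing R] {f g : PowerSeries R}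
    (hf : coeff 0 f = 0) : coeff 0 (f * g) = 0 := by
  simp [coeff_mul, hf]

theorem coeff_zero_mul_of_right {R : Type*} [CommRing R] {f g : PowerSeries R}
    (hg : coeff 0 g = 0) : coeff 0 (f * g) = 0 := by
  simp [coeff_mul, hg]

theorem coeff_mul_mul_eq_sum_Icc {R : Type*} [CommRing R] {f w g : PowerSeries R}
    (hf : coeff 0 f = 0) (hw : coeff 0 w = 0) (hg : coeff 0 g = 0) (n : ℕ) :
    coeff n (f * w * g) = ∑ m ∈ Finset.Icc 1 (n - 2), ∑ k ∈ Finset.Icc 1 (n - m - 1),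
      coeff (n - m - k) w * coeff k f * coeff m g := by
  rw [coeff_mul_eq_sum_Icc (coeff_zero_mul_of_left hf) hg, ← sum_Icc_extend (a := n - 2) (by omega)]
  · refine Finset.sum_congr rfl fun m _ => ?_
    rw [mul_comm f w, coeff_mul_eq_sum_Icc hw hf, Finset.sum_mul]
  -- The convolution allows `m = n - 1`, but then only order 1 is left for two factors that both
  -- start at order 1.
  · intro m hm hm'
    rw [coeff_mul_eq_sum_Icc hf hw, show n - m - 1 = 0 by omega]
    simp

theorem coeff_zero_pdSer_tail (σ : Idx N) (f : FSer N) : coeff 0 (pdSer σ (tail f)) = 0 := by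
  rw [coeff_pdSer, coeff_zero_tail, pd_zero]

theorem coeff_pdSer_tail {n : ℕ} (hn : n ≠ 0) (σ : Idx N) (f : FSer N) :
    coeff n (pdSer σ (tail f)) = pd σ (coeff n f) := by
  rw [coeff_pdSer, coeff_tail hn]

theorem sum_sum_comm {M I J : Type*} [AddCommMonoid M] [Fintype I] (s : Finset J)
    (g : I → I → J → M) : ∑ σ, ∑ ρ, ∑ m ∈ s, g σ ρ m = ∑ m ∈ s, ∑ σ, ∑ ρ, g σ ρ m := by
  rw [Finset.sum_comm]
  simp only [Finset.sum_comm (s := s)]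
  rw [Finset.sum_comm]

theorem coeff_inhomSer {n : ℕ} (hn : 1 ≤ n) (Ω : Matrix (Idx N) (Idx N) (FSer N))
    (η : Idx N → FSer N) (μ ν : Idx N) : coeff n (inhomSer Ω η μ ν) = inhom Ω η n μ ν := by
  have hd := fun σ μ => coeff_zero_pdSer_tail (N := N) σ (η μ)
  have hw := fun σ ρ => coeff_zero_tail (Ω σ ρ)
  have h1 : ∀ σ ρ, coeff n (pdSer σ (tail (η μ)) * C (fun _ => Omega0 N σ ρ)
      * pdSer ρ (tail (η ν))) = ∑ m ∈ Finset.Icc 1 (n - 1), pd σ (coeff (n - m) (η μ))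
        * (fun _ => Omega0 N σ ρ) * pd ρ (coeff m (η ν)) := by
    intro σ ρ
    rw [coeff_mul_eq_sum_Icc (coeff_zero_mul_of_left (hd σ μ)) (hd ρ ν)]
    refine Finset.sum_congr rfl fun m hm => ?_
    rw [Finset.mem_Icc] at hm
    rw [coeff_mul_C, coeff_pdSer_tail (by omega), coeff_pdSer_tail (by omega)]
  have h2 : ∀ σ, coeff n (pdSer σ (tail (η μ)) * tail (Ω σ ν))
      = ∑ m ∈ Finset.Icc 1 (n - 1), pd σ (coeff (n - m) (η μ)) * coeff m (Ω σ ν) := by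
    intro σ
    rw [coeff_mul_eq_sum_Icc (hd σ μ) (hw σ ν)]
    refine Finset.sum_congr rfl fun m hm => ?_
    rw [Finset.mem_Icc] at hm
    rw [coeff_pdSer_tail (by omega), coeff_tail (by omega)]
  have h3 : ∀ σ, coeff n (tail (Ω μ σ) * pdSer σ (tail (η ν)))
      = ∑ m ∈ Finset.Icc 1 (n - 1), coeff (n - m) (Ω μ σ) * pd σ (coeff m (η ν)) := by
    intro σ
    rw [coeff_mul_eq_sum_Icc (hw μ σ) (hd σ ν)]
    refine Finset.sum_congr rfl fun m hm => ?_
    rw [Finset.mem_Icc] at hm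
    rw [coeff_pdSer_tail (by omega), coeff_tail (by omega)]
  have h4 : ∀ σ ρ, coeff n (pdSer σ (tail (η μ)) * tail (Ω σ ρ) * pdSer ρ (tail (η ν)))
      = ∑ m ∈ Finset.Icc 1 (n - 2), ∑ k ∈ Finset.Icc 1 (n - m - 1),
        coeff (n - m - k) (Ω σ ρ) * pd σ (coeff k (η μ)) * pd ρ (coeff m (η ν)) := by
    intro σ ρ
    rw [coeff_mul_mul_eq_sum_Icc (hd σ μ) (hw σ ρ) (hd ρ ν)]
    refine Finset.sum_congr rfl fun m hm => Finset.sum_congr rfl fun k hk => ?_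
    rw [Finset.mem_Icc] at hm hk
    rw [coeff_pdSer_tail (by omega), coeff_pdSer_tail (by omega), coeff_tail (by omega)]
  funext ξ
  rw [inhomSer, inhom]
  simp only [map_add, map_sum, h1, h2, h3, h4, coeff_tail (show n ≠ 0 by omega),
    sum_sum_comm, Finset.sum_comm (s := Finset.univ) (t := Finset.Icc 1 (n - 1))]
  simp only [Pi.add_apply, Finset.sum_apply, Pi.mul_apply, Finset.sum_add_distrib]

theorem coeff_zero_inhomSer (Ω : Matrix (Idx N) (Idx N) (FSer N))
    (η : Idx N → FSer N) (μ ν : Idx N) : coeff 0 (inhomSer Ω η μ ν) = 0 := by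
  simp only [inhomSer, map_add, map_sum, coeff_zero_tail,
    coeff_zero_mul_of_right (coeff_zero_pdSer_tail _ _),
    coeff_zero_mul_of_left (coeff_zero_pdSer_tail _ _), Finset.sum_const_zero, add_zero]

theorem smoothSer_inhomSer (hΩ : IsDeformation Ω) (hη : ∀ μ, SmoothSer (η μ)) (μ ν : Idx N) :
    SmoothSer (inhomSer Ω η μ ν) := by
  have hd : ∀ σ μ, SmoothSer (pdSer σ (tail (η μ))) := fun σ μ => (hη μ).tail.pdSer σ
  have hw : ∀ σ ρ, SmoothSer (tail (Ω σ ρ)) := fun σ ρ => (hΩ.smooth σ ρ).tail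
  refine ((hw μ ν).add (((SmoothSer.sum fun σ _ => SmoothSer.sum fun ρ _ => ?_).add
    (SmoothSer.sum fun σ _ => ?_)).add (SmoothSer.sum fun σ _ => ?_))).add
    (SmoothSer.sum fun σ _ => SmoothSer.sum fun ρ _ => ?_)
  · exact ((hd σ μ).mul (smoothSer_C contDiff_const)).mul (hd ρ ν)
  · exact (hd σ μ).mul (hw σ ν)
  · exact (hw μ σ).mul (hd σ ν)
  · exact ((hd σ μ).mul (hw σ ρ)).mul (hd ρ ν)

theorem contDiff_inhom (hΩ : IsDeformation Ω) (hη : ∀ μ, SmoothSer (η μ)) {n : ℕ} (hn : 1 ≤ n)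
    (μ ν : Idx N) : ContDiff ℝ ∞ (inhom Ω η n μ ν) := by
  rw [← coeff_inhomSer hn]
  exact smoothSer_inhomSer hΩ hη μ ν n

theorem tail_antisymm (hΩ : IsDeformation Ω) (μ ν : Idx N) : tail (Ω ν μ) = -tail (Ω μ ν) := by
  rw [tail, tail, hΩ.antisymm μ ν, map_neg, map_neg]
  ring

theorem sum_antisymm {R I : Type*} [CommRing R] [Fintype I] {w : I → I → R}
    (hw : ∀ i j, w j i = -w i j) (u v : I → R) :
    ∑ i, ∑ j, v i * w i j * u j = -∑ i, ∑ j, u i * w i j * v j := by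
  rw [Finset.sum_comm]
  simp only [← Finset.sum_neg_distrib]
  exact Finset.sum_congr rfl fun i _ => Finset.sum_congr rfl fun j _ => by rw [hw i j]; ring

theorem inhomSer_antisymm (hΩ : IsDeformation Ω) (η : Idx N → FSer N) (μ ν : Idx N) :
    inhomSer Ω η ν μ = -inhomSer Ω η μ ν := by
  have hC : ∀ σ ρ : Idx N, (C (fun _ : Phase N => Omega0 N ρ σ) : FSer N)
      = -C (fun _ => Omega0 N σ ρ) := fun σ ρ => by
    rw [← map_neg]
    congr 1
    funext ξ
    exact Omega0_antisymm σ ρ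
  have h1 : ∀ μ ν, ∑ σ, pdSer σ (tail (η μ)) * tail (Ω σ ν)
      = -∑ σ, tail (Ω ν σ) * pdSer σ (tail (η μ)) := fun μ ν => by
    rw [← Finset.sum_neg_distrib]
    exact Finset.sum_congr rfl fun σ _ => by rw [tail_antisymm hΩ ν σ]; ring
  rw [inhomSer, inhomSer, sum_antisymm hC fun σ => pdSer σ (tail (η μ)),
    sum_antisymm (w := fun σ ρ => tail (Ω σ ρ)) (tail_antisymm hΩ)
      fun σ => pdSer σ (tail (η μ)), h1, h1, tail_antisymm hΩ μ ν]
  ring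

theorem inhom_antisymm (hΩ : IsDeformation Ω) (η : Idx N → FSer N) {n : ℕ} (hn : 1 ≤ n)
    (μ ν : Idx N) : inhom Ω η n ν μ = -inhom Ω η n μ ν := by
  rw [← coeff_inhomSer hn, ← coeff_inhomSer hn, inhomSer_antisymm hΩ, map_neg]

/-- Justifies both the truncation argument and the order-by-order construction. -/
theorem inhom_congr {η' : Idx N → FSer N} {n : ℕ}
    (h : ∀ m, 1 ≤ m → m < n → ∀ μ, coeff m (η μ) = coeff m (η' μ)) :
    inhom Ω η n = inhom Ω η' n := by
  funext μ ν ξ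
  rw [inhom, inhom]
  congr 1
  · congr 1
    refine Finset.sum_congr rfl fun m hm => ?_
    rw [Finset.mem_Icc] at hm
    simp only [h m hm.1 (by omega), h (n - m) (by omega) (by omega)]
  · refine Finset.sum_congr rfl fun m hm => Finset.sum_congr rfl fun k hk => ?_
    rw [Finset.mem_Icc] at hm hk
    simp only [h m hm.1 (by omega), h k hk.1 (by omega)]

theorem darbouxEqAt_congr {η' : Idx N → FSer N} {n : ℕ}
    (h : ∀ m, 1 ≤ m → m ≤ n → ∀ μ, coeff m (η μ) = coeff m (η' μ)) (hn : 1 ≤ n) :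
    DarbouxEqAt Ω η n ↔ DarbouxEqAt Ω η' n := by
  rw [DarbouxEqAt, DarbouxEqAt, inhom_congr fun m hm hmn => h m hm hmn.le]
  simp only [h n hn le_rfl]

theorem coeff_zero_darbouxSer (Ω : Matrix (Idx N) (Idx N) (FSer N))
    (η : Idx N → FSer N) (μ ν : Idx N) : coeff 0 (darbouxSer Ω η μ ν) = 0 := by
  simp only [darbouxSer, map_add, map_sum, coeff_zero_inhomSer,
    coeff_zero_mul_of_right (coeff_zero_pdSer_tail _ _),
    coeff_zero_mul_of_left (coeff_zero_pdSer_tail _ _), Finset.sum_const_zero, add_zero]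

theorem coeff_darbouxSer {n : ℕ} (hn : 1 ≤ n) (Ω : Matrix (Idx N) (Idx N) (FSer N))
    (η : Idx N → FSer N) (μ ν : Idx N) (ξ : Phase N) :
    coeff n (darbouxSer Ω η μ ν) ξ
      = (∑ σ, pd σ (coeff n (η μ)) ξ * Omega0 N σ ν)
        + (∑ σ, Omega0 N μ σ * pd σ (coeff n (η ν)) ξ) + inhom Ω η n μ ν ξ := by
  rw [darbouxSer]
  simp only [map_add, map_sum, coeff_inhomSer hn, coeff_mul_C, coeff_C_mul,
    coeff_pdSer_tail (show n ≠ 0 by omega), Pi.add_apply, Finset.sum_apply, Pi.mul_apply]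

theorem darbouxEqAt_iff {n : ℕ} (hn : 1 ≤ n) :
    DarbouxEqAt Ω η n ↔ ∀ μ ν, coeff n (darbouxSer Ω η μ ν) = 0 := by
  simp only [DarbouxEqAt, DarbouxEq, funext_iff, coeff_darbouxSer hn, Pi.zero_apply]

theorem isDarboux_iff (hΩ : IsDeformation Ω) (hη : IsFormalChange η) :
    IsDarboux Ω η ↔ ∀ n : ℕ, 1 ≤ n → DarbouxEqAt Ω η n := by
  constructor
  · intro h n hn
    rw [darbouxEqAt_iff hn]
    intro μ ν
    have := h.canonical μ ν
    rw [bracket_eq hΩ hη, add_eq_left] at this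
    rw [this, map_zero]
  · refine fun h => ⟨hη, fun μ ν => ?_⟩
    rw [bracket_eq hΩ hη, add_eq_left]
    ext n : 1
    rcases Nat.eq_zero_or_pos n with rfl | hn
    · rw [coeff_zero_darbouxSer, map_zero]
    · rw [(darbouxEqAt_iff hn).1 (h n hn), map_zero]

/-- The formal change of coordinates with the coefficients of `η` in the orders between `1` and
`n - 1` and vanishing higher coefficients. -/
def truncate (η : Idx N → FSer N) (n : ℕ) (μ : Idx N) : FSer N :=
  mk fun m => if m = 0 then fun ξ => ξ μ else if m < n then coeff m (η μ) else 0

theorem coeff_truncate {n m : ℕ} (hm : 1 ≤ m) (hmn : m < n) (η : Idx N → FSer N) (μ : Idx N) :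
    coeff m (truncate η n μ) = coeff m (η μ) := by
  rw [truncate, coeff_mk, if_neg (by omega), if_pos hmn]

theorem coeff_truncate_self {n : ℕ} (hn : 1 ≤ n) (η : Idx N → FSer N) (μ : Idx N) :
    coeff n (truncate η n μ) = 0 := by
  rw [truncate, coeff_mk, if_neg (by omega), if_neg (lt_irrefl n)]

theorem isFormalChange_truncate (hη : ∀ μ, SmoothSer (η μ)) (n : ℕ) :
    IsFormalChange (truncate η n) := by
  refine ⟨fun μ m => ?_, fun μ => by rw [truncate, coeff_mk, if_pos rfl]⟩
  rw [truncate, coeff_mk]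
  split_ifs
  · exact contDiff_coord μ
  · exact hη μ m
  · exact contDiff_const

theorem coeff_zero_pdSer (hη : IsFormalChange η) (σ μ : Idx N) :
    coeff 0 (pdSer σ (η μ)) = if σ = μ then 1 else 0 := by
  rw [pdSer_eq_delta_add hη, map_add, coeff_zero_pdSer_tail, add_zero]
  split_ifs <;> simp

/-- Since `η^n = 0`, the inner bracket has order-`n` coefficient `F^n`, and its lower ones are
constant by the Darboux equations. Its derivatives therefore start at order `n` and meet only the
zeroth coefficients `δ` and `Ω⁰` of the other factors. -/
theorem coeff_bracket_bracket (hΩ : IsDeformation Ω) (hη : IsFormalChange η) {n : ℕ}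
    (hn : 1 ≤ n) (hE : ∀ m, 1 ≤ m → m < n → DarbouxEqAt Ω η m)
    (h0 : ∀ μ, coeff n (η μ) = 0) (α μ ν : Idx N) :
    coeff n (bracket Ω (η α) (bracket Ω (η μ) (η ν))) = hamDeriv α (inhom Ω η n μ ν) := by
  have hlow : ∀ r < n, coeff r (darbouxSer Ω η μ ν) = 0 := by
    intro r hr
    rcases Nat.eq_zero_or_pos r with rfl | hr'
    · exact coeff_zero_darbouxSer Ω η μ ν
    · exact (darbouxEqAt_iff hr').1 (hE r hr' hr) μ ν
  have hcoeff : ∀ r, 1 ≤ r → coeff r (bracket Ω (η μ) (η ν)) = coeff r (darbouxSer Ω η μ ν) := by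
    intro r hr
    rw [bracket_eq hΩ hη, map_add, coeff_C, if_neg (by omega), zero_add]
  have hpd : ∀ ρ, ∀ r < n, coeff r (pdSer ρ (bracket Ω (η μ) (η ν))) = 0 := by
    intro ρ r hr
    rw [coeff_pdSer]
    rcases Nat.eq_zero_or_pos r with rfl | hr'
    · rw [bracket_eq hΩ hη, map_add, coeff_C, if_pos rfl, coeff_zero_darbouxSer, add_zero,
        pd_const]
    · rw [hcoeff r hr', hlow r hr, pd_zero]
  have htop : coeff n (bracket Ω (η μ) (η ν)) = inhom Ω η n μ ν := by
    rw [hcoeff n hn]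
    funext ξ
    simp [coeff_darbouxSer hn, h0]
  funext ξ
  rw [bracket]
  simp only [map_sum, coeff_mul_of_lower_eq_zero _ (hpd _), coeff_pdSer, htop, coeff_mul,
    Finset.Nat.antidiagonal_zero, Finset.sum_singleton, ← coeff_pdSer 0, coeff_zero_pdSer hη,
    hΩ.zeroth, ite_mul, one_mul, zero_mul, Finset.sum_ite_irrel, Finset.sum_const_zero,
    Finset.sum_ite_eq', Finset.mem_univ, if_true]
  rw [← sum_Omega0_mul_pd]
  simp only [Finset.sum_apply, Pi.mul_apply]

theorem cyclicDeriv_inhom (hΩ : IsDeformation Ω) (hη : ∀ μ, SmoothSer (η μ)) {n : ℕ}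
    (hn : 1 ≤ n) (hJ : ∀ r < n, ∀ μ ν α, coeff r (jacobiator Ω μ ν α) = 0)
    (hE : ∀ m, 1 ≤ m → m < n → DarbouxEqAt Ω η m) (α μ ν : Idx N) :
    cyclicDeriv (inhom Ω η n) α μ ν = coeff n (jacobiator Ω α μ ν) := by
  -- Neither `F^n` nor the lower equations involve `η^m` with `m ≥ n`, so these may be set to zero.
  have hc := isFormalChange_truncate hη n
  have hE' : ∀ m, 1 ≤ m → m < n → DarbouxEqAt Ω (truncate η n) m := fun m hm hmn =>
    (darbouxEqAt_congr (fun k hk hkm μ => coeff_truncate hk (by omega) η μ) hm).2 (hE m hm hmn)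
  have key := congrArg (coeff n)
    (bracket_cyclic_sum hΩ (hc.smooth α) (hc.smooth μ) (hc.smooth ν))
  simp only [map_add, coeff_bracket_bracket hΩ hc hn hE' (coeff_truncate_self hn η)] at key
  rw [← cyclicDeriv_eq, inhom_congr fun m hm hmn μ => coeff_truncate hm hmn η μ] at key
  rw [key]
  -- The Jacobiator starts at order `n`, so the gradients contribute only their zeroth coefficients,
  -- Kronecker deltas.
  simp only [map_sum, coeff_mul_of_lower_eq_zero _ fun r hr => hJ r hr _ _ _]
  simp only [coeff_mul, Finset.Nat.antidiagonal_zero, Finset.sum_singleton, coeff_zero_pdSer hc,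
    ite_mul, mul_ite, one_mul, zero_mul, mul_one, mul_zero, Finset.sum_ite_eq',
    Finset.mem_univ, if_true]

end InhomogeneitySeries

/-! ### Construction and classification of the coordinates by recursion on the order. -/

noncomputable section Recursion

open PowerSeries

variable {F : Idx N → Idx N → Fn N}

theorem Generates.smooth (hF : ∀ μ ν, ContDiff ℝ ∞ (F μ ν)) {g : Fn N} {e : Idx N → Fn N}
    (h : Generates F g e) (μ : Idx N) : ContDiff ℝ ∞ (e μ) := by
  obtain ⟨hg, f, hf, -, -, rfl⟩ := h
  exact contDiff_integralSol hF hf hg μ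

theorem Generates.darbouxEq (hF : ∀ μ ν, ContDiff ℝ ∞ (F μ ν)) (hanti : ∀ μ ν, F ν μ = -F μ ν)
    (hI : Integrability F) {g : Fn N} {e : Idx N → Fn N} (h : Generates F g e) :
    DarbouxEq F e := by
  obtain ⟨hg, f, hf, hm, -, rfl⟩ := h
  exact (darbouxEq_integralSol_iff hF hanti hI hf hg).2 hm

theorem Generates.unique (hF : ∀ μ ν, ContDiff ℝ ∞ (F μ ν)) (hanti : ∀ μ ν, F ν μ = -F μ ν)
    (hI : Integrability F) {g : Fn N} {e e' : Idx N → Fn N} (h : Generates F g e)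
    (h' : Generates F g e') : e = e' := by
  obtain ⟨hg, f, hf, hm, hn, rfl⟩ := h
  obtain ⟨-, f', hf', hm', hn', rfl⟩ := h'
  rw [(existsUnique_mixedRelation hF hanti hI hg).unique ⟨hf, hm, hn⟩ ⟨hf', hm', hn'⟩]

theorem exists_generates_of_smooth (hF : ∀ μ ν, ContDiff ℝ ∞ (F μ ν))
    (hanti : ∀ μ ν, F ν μ = -F μ ν) (hI : Integrability F) {g : Fn N} (hg : ContDiff ℝ ∞ g) :
    ∃ e, Generates F g e := by
  obtain ⟨f, ⟨hf, hm, hn⟩, -⟩ := existsUnique_mixedRelation hF hanti hI hg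
  exact ⟨_, hg, f, hf, hm, hn, rfl⟩

open Classical in
/-- The solution generated by `g`, or zero if there is none. -/
def generated (F : Idx N → Idx N → Fn N) (g : Fn N) : Idx N → Fn N :=
  if h : ∃ e, Generates F g e then h.choose else 0

theorem generates_generated {g : Fn N} (h : ∃ e, Generates F g e) :
    Generates F g (generated F g) := by
  rw [generated, dif_pos h]
  exact h.choose_spec

/-- The default value zero makes this independent of solvability, so the partial sums are known to
be smooth before any Darboux equation is established. -/
theorem contDiff_generated (hF : ∀ μ ν, ContDiff ℝ ∞ (F μ ν)) (g : Fn N) (μ : Idx N) :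
    ContDiff ℝ ∞ (generated F g μ) := by
  by_cases h : ∃ e, Generates F g e
  · exact (generates_generated h).smooth hF μ
  · rw [generated, dif_neg h]
    exact contDiff_const

/-- The partial sums of the Darboux coordinates generated by `g`. -/
def partialCoords (Ω : Matrix (Idx N) (Idx N) (FSer N)) (g : FSer N) : ℕ → Idx N → FSer N
  | 0 => fun μ => C fun ξ => ξ μ
  | n + 1 => fun μ => partialCoords Ω g n μ
      + monomial (n + 1) (generated (inhom Ω (partialCoords Ω g n) (n + 1)) (coeff (n + 1) g) μ)

/-- The Darboux coordinates generated by `g`. -/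
def generatedCoords (Ω : Matrix (Idx N) (Idx N) (FSer N)) (g : FSer N) (μ : Idx N) : FSer N :=
  mk fun n => coeff n (partialCoords Ω g n μ)

variable {Ω : Matrix (Idx N) (Idx N) (FSer N)}

theorem smoothSer_partialCoords (hΩ : IsDeformation Ω) (g : FSer N) (n : ℕ) (μ : Idx N) :
    SmoothSer (partialCoords Ω g n μ) := by
  induction n generalizing μ with
  | zero => exact smoothSer_C (contDiff_coord μ)
  | succ n ih =>
    refine SmoothSer.add (ih μ) fun m => ?_
    rw [coeff_monomial]
    split_ifs
    · exact contDiff_generated (contDiff_inhom hΩ ih (by omega)) _ μ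
    · exact contDiff_const

theorem coeff_partialCoords_of_lt {n m : ℕ} (h : n < m) (g : FSer N) (μ : Idx N) :
    coeff m (partialCoords Ω g n μ) = 0 := by
  induction n with
  | zero => rw [partialCoords, coeff_C, if_neg (by omega)]
  | succ n ih => rw [partialCoords, map_add, ih (by omega), coeff_monomial, if_neg (by omega),
      add_zero]

theorem coeff_partialCoords {n m : ℕ} (h : m ≤ n) (g : FSer N) (μ : Idx N) :
    coeff m (partialCoords Ω g n μ) = coeff m (generatedCoords Ω g μ) := by
  rw [generatedCoords, coeff_mk]
  induction n, h using Nat.le_induction with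
  | base => rfl
  | succ n hn ih => rw [partialCoords, map_add, ih, coeff_monomial, if_neg (by omega), add_zero]

/-- The partial sum used in the construction agrees with the full series below order `n`, which is
all that `F^n` depends on. -/
theorem coeff_generatedCoords {n : ℕ} (hn : 1 ≤ n) (g : FSer N) :
    (fun μ => coeff n (generatedCoords Ω g μ))
      = generated (inhom Ω (generatedCoords Ω g) n) (coeff n g) := by
  obtain ⟨n, rfl⟩ : ∃ k, n = k + 1 := ⟨n - 1, by omega⟩
  rw [← inhom_congr fun m hm hmn μ => coeff_partialCoords (n := n) (by omega) g μ]
  funext μ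
  rw [generatedCoords, coeff_mk, partialCoords, map_add, coeff_partialCoords_of_lt (by omega),
    zero_add, coeff_monomial, if_pos rfl]

theorem isFormalChange_generatedCoords (hΩ : IsDeformation Ω) (g : FSer N) :
    IsFormalChange (generatedCoords Ω g) := by
  refine ⟨fun μ n => ?_, fun μ => ?_⟩
  · rw [generatedCoords, coeff_mk]
    exact smoothSer_partialCoords hΩ g n μ n
  · rw [generatedCoords, coeff_mk, partialCoords, coeff_C, if_pos rfl]

theorem integrability_inhom (hΩ : IsDeformation Ω) (hJ : Jacobi Ω) {η : Idx N → FSer N}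
    (hη : ∀ μ, SmoothSer (η μ)) {n : ℕ} (hn : 1 ≤ n)
    (hE : ∀ m, 1 ≤ m → m < n → DarbouxEqAt Ω η m) : Integrability (inhom Ω η n) := by
  intro α μ ν ξ
  rw [cyclicDeriv_inhom hΩ hη hn (fun r _ μ ν α => by rw [hJ, map_zero]) hE, hJ, map_zero]
  rfl

/-- The two claims are proved together: the lower Darboux equations give integrability through
Jacobi, hence a generated solution exists and the default value is not taken, and this solution
satisfies the next equation. -/
theorem generates_generatedCoords (hΩ : IsDeformation Ω) (hJ : Jacobi Ω) {g : FSer N}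
    (hg : SmoothSer g) {n : ℕ} (hn : 1 ≤ n) :
    Generates (inhom Ω (generatedCoords Ω g) n) (coeff n g)
        (fun μ => coeff n (generatedCoords Ω g μ))
      ∧ DarbouxEqAt Ω (generatedCoords Ω g) n := by
  induction n using Nat.strong_induction_on with
  | _ n ih =>
    have hs := (isFormalChange_generatedCoords hΩ g).smooth
    have hF := contDiff_inhom hΩ hs hn
    have hanti := inhom_antisymm hΩ (generatedCoords Ω g) hn
    have hI := integrability_inhom hΩ hJ hs hn fun m hm hmn => (ih m hmn hm).2
    have hG : Generates (inhom Ω (generatedCoords Ω g) n) (coeff n g)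
        (fun μ => coeff n (generatedCoords Ω g μ)) := by
      rw [coeff_generatedCoords hn]
      exact generates_generated (exists_generates_of_smooth hF hanti hI (hg n))
    exact ⟨hG, hG.darbouxEq hF hanti hI⟩

theorem isDarboux_generatedCoords (hΩ : IsDeformation Ω) (hJ : Jacobi Ω) {g : FSer N}
    (hg : SmoothSer g) : IsDarboux Ω (generatedCoords Ω g) :=
  (isDarboux_iff hΩ (isFormalChange_generatedCoords hΩ g)).2 fun _ hn =>
    (generates_generatedCoords hΩ hJ hg hn).2

theorem generatesSer_generatedCoords (hΩ : IsDeformation Ω) (hJ : Jacobi Ω) {g : FSer N}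
    (hg : SmoothSer g) : GeneratesSer Ω g (generatedCoords Ω g) :=
  ⟨isFormalChange_generatedCoords hΩ g, fun _ hn => (generates_generatedCoords hΩ hJ hg hn).1⟩

theorem IsDarboux.integrability (hΩ : IsDeformation Ω) (hJ : Jacobi Ω) {η : Idx N → FSer N}
    (hη : IsDarboux Ω η) {n : ℕ} (hn : 1 ≤ n) : Integrability (inhom Ω η n) :=
  integrability_inhom hΩ hJ hη.change.smooth hn fun m hm _ =>
    (isDarboux_iff hΩ hη.change).1 hη m hm

theorem GeneratesSer.unique (hΩ : IsDeformation Ω) (hJ : Jacobi Ω) {g : FSer N}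
    {η η' : Idx N → FSer N} (hη : IsDarboux Ω η) (h : GeneratesSer Ω g η)
    (h' : GeneratesSer Ω g η') : η = η' := by
  suffices H : ∀ n μ, coeff n (η μ) = coeff n (η' μ) from
    funext fun μ => PowerSeries.ext fun n => H n μ
  intro n
  induction n using Nat.strong_induction_on with
  | _ n ih =>
    intro μ
    rcases Nat.eq_zero_or_pos n with rfl | hn
    · rw [h.1.zeroth, h'.1.zeroth]
    · have h2 := h'.2 n hn
      -- Equal lower coefficients give equal inhomogeneities, so uniqueness in a fixed order
      -- applies.
      rw [← inhom_congr fun m _ hmn μ => ih m hmn μ] at h2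
      exact congrFun ((h.2 n hn).unique (contDiff_inhom hΩ h.1.smooth hn)
        (inhom_antisymm hΩ η hn) (hη.integrability hΩ hJ hn) h2) μ

theorem IsDarboux.exists_generatesSer (hΩ : IsDeformation Ω) (hJ : Jacobi Ω)
    {η : Idx N → FSer N} (hη : IsDarboux Ω η) : ∃ g, SmoothSer g ∧ GeneratesSer Ω g η := by
  have H : ∀ n, ∃ g : Fn N, ContDiff ℝ ∞ g ∧
      (1 ≤ n → Generates (inhom Ω η n) g fun μ => coeff n (η μ)) := by
    intro n
    rcases Nat.eq_zero_or_pos n with rfl | hn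
    -- The zeroth coefficient of `g` plays no role; any smooth function would do.
    · exact ⟨0, contDiff_const, by omega⟩
    · obtain ⟨g, hg⟩ := DarbouxEq.exists_generates (contDiff_inhom hΩ hη.change.smooth hn)
        (inhom_antisymm hΩ η hn) (hη.integrability hΩ hJ hn) (fun μ => hη.change.smooth μ n)
        ((isDarboux_iff hΩ hη.change).1 hη n hn)
      exact ⟨g, hg.1, fun _ => hg⟩
  choose g hg hG using H
  refine ⟨PowerSeries.mk g, fun n => ?_, hη.change, fun n hn => ?_⟩
  · rw [coeff_mk]
    exact hg n
  · rw [coeff_mk]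
    exact hG n hn

theorem GeneratesSer.iff_const (hΩ : IsDeformation Ω) {g : FSer N} {η : Idx N → FSer N}
    (h : GeneratesSer Ω g η) (g' : FSer N) :
    GeneratesSer Ω g' η ↔
      ∀ n : ℕ, 1 ≤ n → ∃ c : ℝ, ∀ ξ, coeff n g' ξ = coeff n g ξ + c := by
  rw [GeneratesSer, and_iff_right h.1]
  exact forall_congr' fun n => forall_congr' fun hn =>
    (h.2 n hn).iff_const (contDiff_inhom hΩ h.1.smooth hn) _

end Recursion

end FormalDarboux

/-! ### Assembly of the main theorem. -/

theorem mainTheorem2 (N : ℕ) (Ω : Matrix (Idx N) (Idx N) (FSer N)) (hΩ : IsDeformation Ω) :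
    -- the Darboux condition is equivalent to the Darboux equations of all orders
    (∀ η : Idx N → FSer N, IsFormalChange η →
      (IsDarboux Ω η ↔ ∀ n : ℕ, 1 ≤ n → DarbouxEqAt Ω η n)) ∧
    -- solvability, and all solutions, in a fixed order
    (∀ (η : Idx N → FSer N) (n : ℕ), (∀ μ, SmoothSer (η μ)) → 1 ≤ n →
      ((∃ e : Idx N → Fn N, (∀ μ, ContDiff ℝ ∞ (e μ)) ∧ DarbouxEq (inhom Ω η n) e) ↔
        Integrability (inhom Ω η n)) ∧
      (Integrability (inhom Ω η n) →
        (∀ f g : Fn N, ContDiff ℝ ∞ f → ContDiff ℝ ∞ g →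
          ((∀ μ, ContDiff ℝ ∞ (integralSol (inhom Ω η n) f g μ)) ∧
            (DarbouxEq (inhom Ω η n) (integralSol (inhom Ω η n) f g) ↔
              MixedRelation (inhom Ω η n) f g))) ∧
        (∀ g : Fn N, ContDiff ℝ ∞ g →
          ∃! f : Fn N, ContDiff ℝ ∞ f ∧ MixedRelation (inhom Ω η n) f g ∧ Normalized f g) ∧
        (∀ e : Idx N → Fn N, (∀ μ, ContDiff ℝ ∞ (e μ)) → DarbouxEq (inhom Ω η n) e →
          ∃ g : Fn N, Generates (inhom Ω η n) g e ∧
            ∀ g' : Fn N, Generates (inhom Ω η n) g' e ↔ ∃ c : ℝ, ∀ ξ, g' ξ = g ξ + c))) ∧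
    -- the auxiliary identities, and the integrability condition as the Jacobi identity
    (∀ (η : Idx N → FSer N) (n : ℕ), (∀ μ, SmoothSer (η μ)) → 1 ≤ n →
      (∀ r < n, ∀ μ ν α, PowerSeries.coeff r (jacobiator Ω μ ν α) = 0) →
      (∀ α μ ν, sumM Ω η n μ ν α + sumM Ω η n ν α μ + sumM Ω η n α μ ν = 0) ∧
      (∀ α μ ν, sumN η n μ ν α + sumN η n ν α μ + sumN η n α μ ν = 0) ∧
      ((∀ m : ℕ, 1 ≤ m → m < n → DarbouxEqAt Ω η m) →
        ∀ α μ ν, cyclicDeriv (inhom Ω η n) α μ ν =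
          PowerSeries.coeff n (jacobiator Ω α μ ν))) ∧
    -- consequences of the Jacobi identity in all orders
    (Jacobi Ω →
      (∀ (η : Idx N → FSer N) (n : ℕ), (∀ μ, SmoothSer (η μ)) → 1 ≤ n →
        (∀ m : ℕ, 1 ≤ m → m < n → DarbouxEqAt Ω η m) → Integrability (inhom Ω η n)) ∧
      (∃ η : Idx N → FSer N, IsDarboux Ω η) ∧
      (∀ g : FSer N, SmoothSer g →
        ∃! η : Idx N → FSer N, IsDarboux Ω η ∧ GeneratesSer Ω g η) ∧
      (∀ η : Idx N → FSer N, IsDarboux Ω η →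
        ∃ g : FSer N, SmoothSer g ∧ GeneratesSer Ω g η ∧
          ∀ g' : FSer N, GeneratesSer Ω g' η ↔
            ∀ n : ℕ, 1 ≤ n → ∃ c : ℝ, ∀ ξ,
              PowerSeries.coeff n g' ξ = PowerSeries.coeff n g ξ + c)) := by
  refine ⟨fun η hη => isDarboux_iff hΩ hη, fun η n hη hn => ?_, fun η n hη hn hJ => ?_,
    fun hJ => ?_⟩
  · have hF := contDiff_inhom hΩ hη hn
    have hanti := inhom_antisymm hΩ η hn
    refine ⟨⟨fun ⟨e, he, h⟩ => h.integrability he, exists_darbouxEq hF hanti⟩, fun hI => ?_⟩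
    refine ⟨fun f g hf hg => ⟨contDiff_integralSol hF hf hg,
      darbouxEq_integralSol_iff hF hanti hI hf hg⟩,
      fun g hg => existsUnique_mixedRelation hF hanti hI hg, fun e he h => ?_⟩
    obtain ⟨g, hg⟩ := h.exists_generates hF hanti hI he
    exact ⟨g, hg, hg.iff_const hF⟩
  · exact ⟨sumM_cyclic_sum hΩ hη hJ, sumN_cyclic_sum hΩ hη n (hJ 0 hn),
      cyclicDeriv_inhom hΩ hη hn hJ⟩
  · refine ⟨fun η n hη hn hE => integrability_inhom hΩ hJ hη hn hE, ?_, fun g hg => ?_,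
      fun η hη => ?_⟩
    · exact ⟨_, isDarboux_generatedCoords hΩ hJ (g := 0) fun n => by
        rw [map_zero]
        exact contDiff_const⟩
    · exact ⟨_, ⟨isDarboux_generatedCoords hΩ hJ hg, generatesSer_generatedCoords hΩ hJ hg⟩,
        fun η' h => h.2.unique hΩ hJ h.1 (generatesSer_generatedCoords hΩ hJ hg)⟩
    · obtain ⟨g, hg, h⟩ := hη.exists_generatesSer hΩ hJ
      exact ⟨g, hg, h, h.iff_const hΩ⟩
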